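/- **Definitions.** A polyhedral terrain over the unit square $D=[0,1]^2$ is a finite triangulation of $D$ with a height function that is affine on each triangle. The geodesic distance of two points of $D$ is the length of a shortest path on the surface between the points above them. For sites $p_1,\dots,p_m\in D$, the Voronoi cell of $p_i$ is the set of points whose geodesic distance to $p_i$ is at most that to every other site. A Voronoi vertex is a point in at least three cells; the Voronoi edges consist of the points in exactly two cells. A breakpoint is a point of a Voronoi edge from which the shortest path to one of its two nearest sites is not unique; the breakpoints cut the Voronoi edges into chords. The complexity of the geodesic Voronoi diagram is the number of Voronoi vertices, plus the number of breakpoints, plus the number of points at which chords meet the edges of the triangulation. **Farming terrain.** Let $c>0$, let $n,m,k\ge 1$ be integers, put $s=1/(c\sqrt m)$, and let $\omega\ge 0$, $\varepsilon>0$, $h>0$. A farming terrain with these parameters is a polyhedral terrain over $D$ as follows. (a) There are $k$ farms, squares of side $s$ touching the west wall $x=0$, the $i$-th one ($0\le i<k$) occupying $[0,s]\times[y_i,y_i+s]$ with $y_i=1-(3i+2)s$ (so adjacent farms are $2s$ apart). (b) Along the east wall there are $2n$ equally wide rectangles (a sequence of $n$ ridges), each extending from the south to the north wall, together occupying $[w,1]\times[0,1]$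 with $w=1-\frac{1}{\sqrt2\,c\,2^n}$; on them the height rises from west to east with slope $45^\circ$ from $h$ on the 1st, 3rd, … rectangle, and falls with slope $45^\circ$ back to $h$ on the 2nd, 4th, … (so the geodesic distance across all ridges is $1/(c2^n)$). (c) From the south-east corner of each farm a road $[s,w]\times[y_i,y_i+\omega]$ leads to the first ridge. (d) The height is $h$ on farms and roads, it is $0$ at every point of $D$ whose distance from all farms, roads and ridges is at least $\varepsilon$, and it is between $0$ and $h$ everywhere else off the ridges. **Lemma.** Let $c,\kappa>0$. There are constants $A$, $K>0$ and $m_0$, depending only on $c$ and $\kappa$, such that for every $C$ there is $n_0$ with the following property. Let $n\ge n_0$ and $m\ge m_0$ with $m\le Cn$. Then there are $\eta>0$ and $h_0$ such that for all integers $k$ with $\kappa\sqrt m\le k\le c\sqrt m/3$, all $\omega\in[0,\eta)$, all $\varepsilon\in(0,\eta)$ and all $h\ge h_0$: (1) there is a farming terrain with these parameters whose triangulation has at most $A\,n$ vertices; and (2) on every farming terrain with these parameters, the geodesic Voronoi diagram of $m$ independent uniformly random sites in $D$ has expected complexity at least $K\,n\sqrt m$. -/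

import Mathlib

open scoped ENNReal

noncomputable section

namespace Farming

/-- The `(x, y)`-plane with its Euclidean norm; `p 0` is the `x`- and `p 1` the `y`-coordinate. -/
abbrev Plane : Type := EuclideanSpace ℝ (Fin 2)

/-- The domain of all terrains. Its west, east, south and north walls are
`x = 0`, `x = 1`, `y = 0` and `y = 1`. -/
def unitSquare : Set Plane := {p | ∀ i, p i ∈ Set.Icc (0 : ℝ) 1}

/-- A polyhedral terrain over the unit square: a finite triangulation of the square, and
a height function which is affine on every simplex of the triangulation (so that, on the square,
it is the linear interpolation of its values at the vertices). -/
structure Terrain where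
  triangulation : Geometry.SimplicialComplex ℝ Plane
  finite_faces : triangulation.faces.Finite
  space_eq : triangulation.space = unitSquare
  height : Plane → ℝ
  affine_on_faces : ∀ s ∈ triangulation.faces, ∃ A : Plane →ᵃ[ℝ] ℝ,
    Set.EqOn height A (convexHull ℝ (s : Set Plane))

namespace Terrain

variable (T : Terrain)

/-- The point of the surface above a point of the plane. -/
def lift (p : Plane) : EuclideanSpace ℝ (Fin 3) := !₂[p 0, p 1, T.height p]

/-- The length of the curve on the surface of the terrain that lies above a path in the square. -/
def pathLength {p q : unitSquare} (γ : Path p q) : ℝ≥0∞ :=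
  eVariationOn (fun t => T.lift (γ t)) Set.univ

/-- The geodesic distance: the least length of a path on the surface. (Paths on the surface
are the lifts of the paths in the square.) -/
def geoDist (p q : unitSquare) : ℝ≥0∞ := ⨅ γ : Path p q, T.pathLength γ

/-- All shortest paths between the two points coincide as curves on the surface
(that is, up to parametrization). -/
def UniqueShortestPath (p q : unitSquare) : Prop :=
  ∀ γ γ' : Path p q, T.pathLength γ = T.geoDist p q → T.pathLength γ' = T.geoDist p q →
    Set.range γ = Set.range γ'

/-- The union of the vertices and edges of the triangulation. -/
def skeleton : Set unitSquare :=
  {z | ∃ s ∈ T.triangulation.faces, s.card ≤ 2 ∧ (z : Plane) ∈ convexHull ℝ (s : Set Plane)}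

variable {m : ℕ} (P : Fin m → unitSquare)

/-- The geodesic Voronoi cell of the site `P i`. -/
def cell (i : Fin m) : Set unitSquare := {z | ∀ j, T.geoDist z (P i) ≤ T.geoDist z (P j)}

/-- The sites whose Voronoi cells contain `z`. -/
def incident (z : unitSquare) : Set (Fin m) := {i | z ∈ T.cell P i}

/-- The points that are incident to at least three cells. -/
def voronoiVertices : Set unitSquare := {z | 3 ≤ (T.incident P z).encard}

/-- The union of all Voronoi edges: the points of bisectors incident to exactly two cells. -/
def voronoiEdgePoints : Set unitSquare := {z | (T.incident P z).encard = 2}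

/-- The points of Voronoi edges at which the shortest path to one of the two sites
is not unique. -/
def breakpoints : Set unitSquare :=
  {z | z ∈ T.voronoiEdgePoints P ∧ ∃ i ∈ T.incident P z, ¬ T.UniqueShortestPath z (P i)}

/-- The union of all chords: the breakpoints cut the Voronoi edges into the chords. -/
def chordPoints : Set unitSquare := T.voronoiEdgePoints P \ T.breakpoints P

/-- The combinatorial complexity of the geodesic Voronoi diagram: the number of Voronoi vertices,
plus the number of breakpoints of Voronoi edges, plus the number of intersections of chords
with the triangulation. -/
def voronoiComplexity : ℕ∞ :=
  (T.voronoiVertices P).encard + (T.breakpoints P).encard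
    + (T.chordPoints P ∩ T.skeleton).encard

end Terrain

/-- The uniform distribution on the unit square. -/
def uniformSquare : MeasureTheory.Measure unitSquare :=
  MeasureTheory.Measure.comap Subtype.val MeasureTheory.volume

/-- The law of `m` independent uniform random points of the unit square. -/
def siteLaw (m : ℕ) : MeasureTheory.Measure (Fin m → unitSquare) :=
  MeasureTheory.Measure.pi fun _ => uniformSquare

/-- The expected complexity of the geodesic Voronoi diagram of `m` independent uniform
random sites. -/
def expectedComplexity (T : Terrain) (m : ℕ) : ℝ≥0∞ :=
  ∫⁻ P, (T.voronoiComplexity P : ℝ≥0∞) ∂(siteLaw m)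

/-- The side length of a farm. -/
def farmSide (c : ℝ) (m : ℕ) : ℝ := 1 / (c * √(m : ℝ))

/-- The `y`-coordinate of the southern side of the `i`-th farm, counted from the north;
consecutive farms are `2 / (c √m)` apart. -/
def farmSouth (c : ℝ) (m i : ℕ) : ℝ := 1 - (3 * i + 2) * farmSide c m

/-- The `i`-th farm, a square that touches the west wall. -/
def farm (c : ℝ) (m i : ℕ) : Set Plane :=
  {p | p 0 ∈ Set.Icc 0 (farmSide c m) ∧
    p 1 ∈ Set.Icc (farmSouth c m i) (farmSouth c m i + farmSide c m)}

/-- The width, in the projection, of the sequence of ridges. All the rectangles have slope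
`± 45°`, so the geodesic distance across the sequence is `√2` times this, which is
`1 / (c 2 ^ n)`. -/
def ridgesWidth (c : ℝ) (n : ℕ) : ℝ := 1 / (√2 * (c * 2 ^ n))

/-- The `x`-coordinate of the west edge of the first ridge. -/
def ridgesWest (c : ℝ) (n : ℕ) : ℝ := 1 - ridgesWidth c n

/-- The `x`-coordinate of the west edge of the `j`-th rectangle (`j = 0, …, 2n - 1`) of the
sequence of ridges. -/
def ridgeLine (c : ℝ) (n j : ℕ) : ℝ := ridgesWest c n + j * (ridgesWidth c n / (2 * n))

/-- The part of the square that is covered by the ridges, from the north to the south wall. -/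
def ridges (c : ℝ) (n : ℕ) : Set Plane := {p | p ∈ unitSquare ∧ ridgesWest c n ≤ p 0}

/-- The road, of width `ω`, from the south-east corner of the `i`-th farm
due east to the first ridge. -/
def road (c : ℝ) (n m : ℕ) (ω : ℝ) (i : ℕ) : Set Plane :=
  {p | p 0 ∈ Set.Icc (farmSide c m) (ridgesWest c n) ∧
    p 1 ∈ Set.Icc (farmSouth c m i) (farmSouth c m i + ω)}

/-- Everything that is built: `k` farms with their roads, and the ridges. -/
def builtArea (c : ℝ) (n m k : ℕ) (ω : ℝ) : Set Plane :=
  (⋃ i < k, farm c m i ∪ road c n m ω i) ∪ ridges c n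

/-- `T` is a farming terrain with `k` farms (sized for `m` sites), a sequence of ridges of
length `n`, roads of width `ω`, steep boundary regions of width `ε` and height `h`. -/
structure IsFarmingTerrain (T : Terrain) (c : ℝ) (n m k : ℕ) (ω ε h : ℝ) : Prop where
  /-- Farms and roads are flat, at height `h`. -/
  height_farm_road : ∀ i < k, ∀ p ∈ farm c m i ∪ road c n m ω i, T.height p = h
  /-- The first, third, … rectangle of the ridges rises from `h` to the east at `45°`. -/
  height_ridge_up : ∀ j < 2 * n, Even j → ∀ p ∈ unitSquare,
    p 0 ∈ Set.Icc (ridgeLine c n j) (ridgeLine c n (j + 1)) →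
      T.height p = h + (p 0 - ridgeLine c n j)
  /-- The second, fourth, … rectangle of the ridges descends to `h` to the east at `45°`. -/
  height_ridge_down : ∀ j < 2 * n, Odd j → ∀ p ∈ unitSquare,
    p 0 ∈ Set.Icc (ridgeLine c n j) (ridgeLine c n (j + 1)) →
      T.height p = h + (ridgeLine c n (j + 1) - p 0)
  /-- The forbidden area has height `0`, except within distance `ε` of what is built. -/
  height_forbidden : ∀ p ∈ unitSquare, (∀ q ∈ builtArea c n m k ω, ε ≤ dist p q) →
    T.height p = 0
  /-- In the boundary regions the height is between `0` and `h`. -/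
  height_boundary : ∀ p ∈ unitSquare, p ∉ builtArea c n m k ω → T.height p ∈ Set.Icc 0 h

end Farming

end

/-!
Take every height `h ≥ 4`. A path that descends to height `0` then costs at least `4`, as does one
that leaves the ridges through a road other than the one considered, so from a point of a ridge
line (a north–south line along which two ridge rectangles meet) the cheap connections run along
the ridge lines and one road into a farm. Hence, if the south side of an occupied farm is level
with a point of a ridge line, every site nearest to that point lies in that farm. Between the
levels of two consecutive occupied farms the nearest site must change along each of the `2n - 1`
interior ridge lines, and where it changes the point belongs to at least two cells. Such a point
lies on an edge of the triangulation, because the surface is bent there, so it is a Voronoi vertex,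
a breakpoint, or a meeting point of a chord with the triangulation. The complexity is therefore at
least `(2n - 1) (N - 1)`, where `N` is the number of occupied farms, as soon as no site falls on the
thin strips formed by the slopes, the roads and the ridges.

A farm has area `1 / (c² m)`, so it is occupied with probability at least `1 - exp (-1 / c²)`, and
the expectation of `N` is of the order of `k ≥ κ √m`.

The farming terrain of small complexity is triangulated in vertical strips: a grid resolves the
farms and roads west of the ridges, each ridge rectangle is halved by a diagonal, and a fan joins
the grid to the first ridge.
-/

noncomputable section

namespace Farming

section Complexes

variable {E : Type*} [AddCommGroup E] [Module ℝ E]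

theorem affineMap_sum_smul (ℓ : E →ᵃ[ℝ] ℝ) (s : Finset E) (w : E → ℝ) (hw : ∑ v ∈ s, w v = 1) :
    ℓ (∑ v ∈ s, w v • v) = ∑ v ∈ s, w v * ℓ v := by
  have h := s.map_affineCombination id w hw ℓ
  rw [s.affineCombination_eq_linear_combination _ _ hw,
    s.affineCombination_eq_linear_combination _ _ hw] at h
  exact h

theorem affineMap_mem_of_mem_convexHull (A : E →ᵃ[ℝ] ℝ) {s : Set E} {I : Set ℝ} (hI : Convex ℝ I)
    (h : ∀ v ∈ s, A v ∈ I) {x : E} (hx : x ∈ convexHull ℝ s) : A x ∈ I :=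
  convexHull_min (t := A ⁻¹' I) h (hI.affine_preimage A) hx

theorem eqOn_convexHull {A B : E →ᵃ[ℝ] ℝ} {s : Set E} (h : Set.EqOn A B s) :
    Set.EqOn A B (convexHull ℝ s) :=
  (AffineMap.eqOn_affineSpan h).mono (convexHull_subset_affineSpan s)

/-- Two simplices, given by their vertex sets, are conformal if they meet only in the simplex
spanned by their common vertices. This is the compatibility condition of a simplicial complex. -/
def Conformal (s t : Finset E) : Prop :=
  convexHull ℝ (s : Set E) ∩ convexHull ℝ (t : Set E) ⊆ convexHull ℝ (s ∩ t : Set E)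

theorem Conformal.symm {s t : Finset E} (h : Conformal s t) : Conformal t s := by
  unfold Conformal at *
  rwa [Set.inter_comm, Set.inter_comm (t : Set E)]

theorem conformal_of_affineIndependent {s t : Finset E} {e : Set E}
    (he : AffineIndependent ℝ ((↑) : e → E)) (hs : ↑s ⊆ e) (ht : ↑t ⊆ e) : Conformal s t := by
  classical
  have hst : AffineIndependent ℝ ((↑) : (s ∪ t : Finset E) → E) :=
    he.mono (s := ((s ∪ t : Finset E) : Set E)) (by simpa using ⟨hs, ht⟩)
  exact (hst.convexHull_inter Finset.subset_union_left Finset.subset_union_right).ge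

theorem Conformal.subset {s t s' t' : Finset E} (h : Conformal s t)
    (hsi : AffineIndependent ℝ ((↑) : s → E)) (hti : AffineIndependent ℝ ((↑) : t → E))
    (hs : s' ⊆ s) (ht : t' ⊆ t) : Conformal s' t' := by
  classical
  rintro x ⟨hx, hx'⟩
  have hst : x ∈ convexHull ℝ ((s ∩ t : Finset E) : Set E) := by
    rw [Finset.coe_inter]
    exact h ⟨convexHull_mono (Finset.coe_subset.2 hs) hx,
      convexHull_mono (Finset.coe_subset.2 ht) hx'⟩
  have hxs : x ∈ convexHull ℝ ((s' ∩ (s ∩ t) : Finset E) : Set E) := by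
    rw [Finset.coe_inter]
    exact (hsi.convexHull_inter hs Finset.inter_subset_left).ge ⟨hx, hst⟩
  have hxt : x ∈ convexHull ℝ ((t' ∩ (s ∩ t) : Finset E) : Set E) := by
    rw [Finset.coe_inter]
    exact (hti.convexHull_inter ht Finset.inter_subset_right).ge ⟨hx', hst⟩
  refine convexHull_mono ?_ ((hsi.convexHull_inter
    (Finset.inter_subset_right.trans Finset.inter_subset_left)
    (Finset.inter_subset_right.trans Finset.inter_subset_left)).ge ⟨hxs, hxt⟩)
  rintro v ⟨hv, hv'⟩
  exact ⟨(Finset.mem_inter.1 hv).1, (Finset.mem_inter.1 hv').1⟩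

theorem mem_convexHull_filter_of_nonpos {s : Finset E} {ℓ : E →ᵃ[ℝ] ℝ} (hs : ∀ v ∈ s, ℓ v ≤ 0)
    {x : E} (hx : x ∈ convexHull ℝ (s : Set E)) (h : 0 ≤ ℓ x) :
    x ∈ convexHull ℝ ((s.filter fun v => ℓ v = 0 : Finset E) : Set E) := by
  obtain ⟨w, hw, hw1, rfl⟩ := Finset.mem_convexHull'.1 hx
  rw [affineMap_sum_smul ℓ s w hw1] at h
  have hle : ∀ v ∈ s, w v * ℓ v ≤ 0 := fun v hv =>
    mul_nonpos_of_nonneg_of_nonpos (hw v hv) (hs v hv)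
  have hprod : ∀ v ∈ s, w v * ℓ v = 0 :=
    (Finset.sum_eq_zero_iff_of_nonpos hle).1 (le_antisymm (Finset.sum_nonpos hle) h)
  have hsupp : ∀ v ∈ s, w v ≠ 0 → ℓ v = 0 := fun v hv hne =>
    (mul_eq_zero.1 (hprod v hv)).resolve_left hne
  refine Finset.mem_convexHull'.2 ⟨w, fun v hv => hw v (Finset.mem_filter.1 hv).1, ?_, ?_⟩
  · rwa [Finset.sum_filter_of_ne hsupp]
  · rw [Finset.sum_filter_of_ne fun v hv hne => hsupp v hv (left_ne_zero_of_smul hne)]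

theorem conformal_of_separated {s t : Finset E} (ℓ : E →ᵃ[ℝ] ℝ) (hs : ∀ v ∈ s, ℓ v ≤ 0)
    (ht : ∀ v ∈ t, 0 ≤ ℓ v)
    (h : Conformal (s.filter fun v => ℓ v = 0) (t.filter fun v => ℓ v = 0)) :
    Conformal s t := by
  rintro x ⟨hxs, hxt⟩
  have hle : ℓ x ≤ 0 := affineMap_mem_of_mem_convexHull ℓ (convex_Iic 0) hs hxs
  have hge : 0 ≤ ℓ x := affineMap_mem_of_mem_convexHull ℓ (convex_Ici 0) ht hxt
  have hxs' := mem_convexHull_filter_of_nonpos hs hxs hge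
  have hxt' := mem_convexHull_filter_of_nonpos (ℓ := -ℓ) (fun v hv => neg_nonpos.2 (ht v hv)) hxt
    (neg_nonneg.2 hle)
  have hfilter : (t.filter fun v => (-ℓ) v = 0) = t.filter fun v => ℓ v = 0 :=
    Finset.filter_congr fun v _ => neg_eq_zero
  exact convexHull_mono (Set.inter_subset_inter (Finset.coe_subset.2 (Finset.filter_subset _ _))
    (Finset.coe_subset.2 (Finset.filter_subset _ _))) (h ⟨hxs', hfilter ▸ hxt'⟩)

/-- The simplicial complex generated by a family of pairwise conformal simplices. -/
def complexOfFamily (F : Set (Finset E)) (hi : ∀ t ∈ F, AffineIndependent ℝ ((↑) : t → E))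
    (hF : ∀ s ∈ F, ∀ t ∈ F, Conformal s t) : Geometry.SimplicialComplex ℝ E where
  faces := {s | s.Nonempty ∧ ∃ t ∈ F, s ⊆ t}
  isRelLowerSet_faces := by
    rintro s ⟨hs, t, ht, hst⟩
    exact ⟨hs, fun u hus hu => ⟨hu, t, ht, hus.trans hst⟩⟩
  indep := by
    rintro s ⟨-, t, ht, hst⟩
    exact (hi t ht).mono (s := (s : Set E)) (Finset.coe_subset.2 hst)
  inter_subset_convexHull := by
    rintro s s' ⟨-, t, ht, hst⟩ ⟨-, t', ht', hst'⟩
    exact (hF t ht t' ht').subset (hi t ht) (hi t' ht') hst hst'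

theorem exists_affineMap_eqOn {s : Set E} (hs : AffineIndependent ℝ ((↑) : s → E)) (f : E → ℝ) :
    ∃ A : E →ᵃ[ℝ] ℝ, Set.EqOn A f s := by
  rcases s.eq_empty_or_nonempty with rfl | ⟨v₀, hv₀⟩
  · exact ⟨0, Set.eqOn_empty _ _⟩
  obtain ⟨t, hst, ht, htop⟩ := exists_subset_affineIndependent_affineSpan_eq_top hs
  let b : AffineBasis t ℝ E := ⟨(↑), ht, by simpa using htop⟩
  let i₀ : t := ⟨v₀, hst hv₀⟩
  let L : E →ₗ[ℝ] ℝ := (b.basisOf i₀).constr ℝ fun i => f i - f v₀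
  refine ⟨L.toAffineMap.comp (AffineMap.id ℝ E - AffineMap.const ℝ E v₀) +
    AffineMap.const ℝ E (f v₀), fun v hv => ?_⟩
  change L (v - v₀) + f v₀ = f v
  by_cases hvv : v = v₀
  · simp [hvv]
  · have hbasis := (b.basisOf i₀).constr_basis ℝ (fun i => f i - f v₀)
      ⟨⟨v, hst hv⟩, fun h => hvv (congrArg Subtype.val h)⟩
    rw [b.basisOf_apply] at hbasis
    exact (congrArg (· + f v₀) hbasis).trans (sub_add_cancel _ _)

theorem exists_interpolation (K : Geometry.SimplicialComplex ℝ E) (f : E → ℝ) :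
    ∃ H : E → ℝ, ∀ s ∈ K.faces, ∃ A : E →ᵃ[ℝ] ℝ,
      Set.EqOn A f s ∧ Set.EqOn H A (convexHull ℝ (s : Set E)) := by
  choose! A hA using fun (s : Finset E) (hs : s ∈ K.faces) => exists_affineMap_eqOn (K.indep hs) f
  have hglue : ∀ x, ∃ y : ℝ, ∀ s ∈ K.faces, x ∈ convexHull ℝ (s : Set E) → y = A s x := by
    intro x
    by_cases hx : ∃ s ∈ K.faces, x ∈ convexHull ℝ (s : Set E)
    · obtain ⟨s, hs, hxs⟩ := hx
      refine ⟨A s x, fun t ht hxt => ?_⟩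
      refine eqOn_convexHull (s := (s ∩ t : Set E)) (fun v hv => ?_)
        (K.inter_subset_convexHull hs ht ⟨hxs, hxt⟩)
      rw [hA s hs hv.1, hA t ht hv.2]
    · exact ⟨0, fun s hs hxs => (hx ⟨s, hs, hxs⟩).elim⟩
  choose H hH using hglue
  exact ⟨H, fun s hs => ⟨A s, hA s hs, fun x hx => hH x s hs hx⟩⟩

end Complexes

section Plane

/-- The point of the plane with the given coordinates. -/
def pt (x y : ℝ) : Plane := !₂[x, y]

@[simp] theorem pt_zero (x y : ℝ) : pt x y 0 = x := rfl

@[simp] theorem pt_one (x y : ℝ) : pt x y 1 = y := rfl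

theorem plane_ext {p q : Plane} (h0 : p 0 = q 0) (h1 : p 1 = q 1) : p = q := by
  ext i; fin_cases i <;> assumption

/-- The product of two sets of coordinates, as a subset of the plane. -/
def rect (A B : Set ℝ) : Set Plane := {p | p 0 ∈ A ∧ p 1 ∈ B}

theorem unitSquare_eq_rect : unitSquare = rect (Set.Icc 0 1) (Set.Icc 0 1) :=
  Set.ext fun _ => Fin.forall_fin_two

theorem pt_mem_unitSquare {x y : ℝ} (hx : x ∈ Set.Icc (0 : ℝ) 1) (hy : y ∈ Set.Icc (0 : ℝ) 1) :
    pt x y ∈ unitSquare :=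
  Fin.forall_fin_two.2 ⟨hx, hy⟩

theorem convex_rect {A B : Set ℝ} (hA : Convex ℝ A) (hB : Convex ℝ B) : Convex ℝ (rect A B) :=
  (hA.linear_preimage (EuclideanSpace.proj (0 : Fin 2) : Plane →L[ℝ] ℝ).toLinearMap).inter
    (hB.linear_preimage (EuclideanSpace.proj (1 : Fin 2) : Plane →L[ℝ] ℝ).toLinearMap)

theorem convex_unitSquare : Convex ℝ unitSquare :=
  unitSquare_eq_rect ▸ convex_rect (convex_Icc 0 1) (convex_Icc 0 1)

theorem mem_segment_of_vertical {p q r : Plane} (hq : q 0 = p 0) (hr : r 0 = p 0)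
    (hqp : q 1 ≤ p 1) (hpr : p 1 ≤ r 1) : p ∈ segment ℝ q r := by
  obtain ⟨u, v, hu, hv, huv, hp⟩ : p 1 ∈ segment ℝ (q 1) (r 1) := by
    rw [segment_eq_Icc (hqp.trans hpr)]
    exact ⟨hqp, hpr⟩
  refine ⟨u, v, hu, hv, huv, plane_ext ?_ hp⟩
  rw [PiLp.add_apply, PiLp.smul_apply, PiLp.smul_apply, hq, hr, ← add_smul, huv, one_smul]

/-- The affine function `p ↦ a x + b y + d`. -/
def affineFn (a b d : ℝ) : Plane →ᵃ[ℝ] ℝ :=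
  (a • (EuclideanSpace.proj (0 : Fin 2) : Plane →L[ℝ] ℝ).toLinearMap
    + b • (EuclideanSpace.proj (1 : Fin 2) : Plane →L[ℝ] ℝ).toLinearMap).toAffineMap
    + AffineMap.const ℝ Plane d

@[simp] theorem affineFn_apply (a b d : ℝ) (p : Plane) :
    affineFn a b d p = a * p 0 + b * p 1 + d := by
  simp [affineFn]

theorem affineIndependent_pair {p q : Plane} (h : p ≠ q) :
    AffineIndependent ℝ ((↑) : ({p, q} : Set Plane) → Plane) := by
  have hrange : Set.range ![p, q] = {p, q} := by
    simp only [Matrix.range_cons, Matrix.range_empty, Set.union_empty, Set.singleton_union]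
  exact hrange ▸ (affineIndependent_of_ne ℝ h).range

theorem affineIndependent_triple (ℓ : Plane →ᵃ[ℝ] ℝ) {p q r : Plane} (h : p ≠ q) (hpq : ℓ p = ℓ q)
    (hr : ℓ r ≠ ℓ p) : AffineIndependent ℝ ((↑) : ({p, q, r} : Set Plane) → Plane) := by
  have hline : Set.EqOn ℓ (AffineMap.const ℝ Plane (ℓ p)) line[ℝ, p, q] :=
    AffineMap.eqOn_affineSpan (by rintro v (rfl | rfl) <;> simp [hpq])
  have hrange : Set.range ![p, q, r] = {p, q, r} := by
    simp only [Matrix.range_cons, Matrix.range_empty, Set.union_empty, Set.singleton_union]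
  exact hrange ▸ (affineIndependent_of_ne_of_mem_of_mem_of_notMem h
    (left_mem_affineSpan_pair ℝ p q) (right_mem_affineSpan_pair ℝ p q)
    fun hmem => hr (hline hmem)).range

theorem exists_sign_change (g : ℕ → ℝ) {i₁ i₂ : ℕ} (hlt : i₁ < i₂) (h₁ : 0 ≤ g i₁)
    (h₂ : g i₂ ≤ 0) : ∃ i, i₁ ≤ i ∧ i < i₂ ∧ 0 ≤ g i ∧ g (i + 1) ≤ 0 := by
  induction i₂, hlt using Nat.le_induction with
  | base => exact ⟨i₁, le_rfl, Nat.lt_succ_self _, h₁, h₂⟩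
  | succ j hj ih =>
    rcases le_total (g j) 0 with h | h
    · obtain ⟨i, hi, hij, hsign⟩ := ih h
      exact ⟨i, hi, hij.trans (Nat.lt_succ_self _), hsign⟩
    · exact ⟨j, (Nat.le_succ _).trans hj, Nat.lt_succ_self _, h, h₂⟩

theorem conformal_of_column_le {x b : ℝ} {s t : Finset Plane} (hs : ∀ v ∈ s, v 0 = x ∧ v 1 ≤ b)
    (ht : ∀ v ∈ t, v 0 = x ∧ b ≤ v 1) : Conformal s t := by
  refine conformal_of_separated (affineFn 0 1 (-b)) (fun v hv => by simp [(hs v hv).2])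
    (fun v hv => by simp [(ht v hv).2]) (conformal_of_affineIndependent (e := {pt x b})
    (affineIndependent_of_subsingleton _ _) (fun v hv => ?_) fun v hv => ?_) <;>
  simp only [Finset.coe_filter, Set.mem_ofPred_eq, affineFn_apply, zero_mul, one_mul, zero_add,
    add_neg_eq_zero] at hv
  · exact plane_ext (hs v hv.1).1 hv.2
  · exact plane_ext (ht v hv.1).1 hv.2

theorem conformal_of_subset_column (x : ℝ) {y : ℕ → ℝ} (hy : StrictMono y) {d d' e e' : ℕ}
    (hd : d ≤ d') (hd' : d' ≤ d + 1) (he : e ≤ e') (he' : e' ≤ e + 1) {s t : Finset Plane}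
    (hs : ↑s ⊆ ({pt x (y d), pt x (y d')} : Set Plane))
    (ht : ↑t ⊆ ({pt x (y e), pt x (y e')} : Set Plane)) : Conformal s t := by
  have hbound : ∀ {d d' : ℕ}, d ≤ d' → ∀ {v : Plane}, v ∈ ({pt x (y d), pt x (y d')} : Set Plane) →
      v 0 = x ∧ v 1 ∈ Set.Icc (y d) (y d') := by
    rintro d d' h v (rfl | rfl)
    exacts [⟨rfl, le_rfl, hy.monotone h⟩, ⟨rfl, hy.monotone h, le_rfl⟩]
  by_cases hde : d' ≤ e
  · exact conformal_of_column_le (b := y e)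
      (fun v hv => (hbound hd (hs hv)).imp_right fun h => h.2.trans (hy.monotone hde))
      (fun v hv => (hbound he (ht hv)).imp_right And.left)
  by_cases hed : e' ≤ d
  · exact (conformal_of_column_le (b := y d)
      (fun v hv => (hbound he (ht hv)).imp_right fun h => h.2.trans (hy.monotone hed))
      (fun v hv => (hbound hd (hs hv)).imp_right And.left)).symm
  obtain rfl : d = e := by lia
  obtain rfl : d' = d + 1 := by lia
  obtain rfl : e' = d + 1 := by lia
  refine conformal_of_affineIndependent (affineIndependent_pair fun h => ?_) hs ht
  exact (hy (Nat.lt_succ_self d)).ne (congrArg (fun p : Plane => p 1) h)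

end Plane

/-- Data for a triangulation of the unit square by vertical strips. The column at `X a` is
subdivided at the levels `Y a b`; the edges that cross the strip between the columns `a` and
`a + 1` join the levels `β a i` and `δ a i`, for `i = 0, …, len a`. -/
structure StripSystem where
  numStrips : ℕ
  X : ℕ → ℝ
  Y : ℕ → ℕ → ℝ
  β : ℕ → ℕ → ℕ
  δ : ℕ → ℕ → ℕ
  len : ℕ → ℕ
  X_strictMono : StrictMono X
  Y_strictMono : ∀ a, StrictMono (Y a)
  X_zero : X 0 = 0
  X_last : X numStrips = 1
  β_zero : ∀ a, β a 0 = 0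
  δ_zero : ∀ a, δ a 0 = 0
  β_mono : ∀ a, Monotone (β a)
  δ_mono : ∀ a, Monotone (δ a)
  step : ∀ a i, β a (i + 1) + δ a (i + 1) = β a i + δ a i + 1
  Y_zero : ∀ a, Y a 0 = 0
  Y_β_len : ∀ a < numStrips, Y a (β a (len a)) = 1
  Y_δ_len : ∀ a < numStrips, Y (a + 1) (δ a (len a)) = 1

namespace StripSystem

variable (S : StripSystem)

/-- The western end of a cross edge. -/
def west (a i : ℕ) : Plane := pt (S.X a) (S.Y a (S.β a i))

/-- The eastern end of a cross edge. -/
def east (a i : ℕ) : Plane := pt (S.X (a + 1)) (S.Y (a + 1) (S.δ a i))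

@[simp] theorem west_apply_zero (a i : ℕ) : S.west a i 0 = S.X a := rfl

@[simp] theorem west_apply_one (a i : ℕ) : S.west a i 1 = S.Y a (S.β a i) := rfl

@[simp] theorem east_apply_zero (a i : ℕ) : S.east a i 0 = S.X (a + 1) := rfl

@[simp] theorem east_apply_one (a i : ℕ) : S.east a i 1 = S.Y (a + 1) (S.δ a i) := rfl

open scoped Classical in
/-- The triangle between two consecutive cross edges; two of the four points coincide. -/
def tri (a i : ℕ) : Finset Plane := {S.west a i, S.west a (i + 1), S.east a i, S.east a (i + 1)}

theorem mem_tri {a i : ℕ} {v : Plane} : v ∈ S.tri a i ↔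
    v = S.west a i ∨ v = S.west a (i + 1) ∨ v = S.east a i ∨ v = S.east a (i + 1) := by
  simp [tri]

/-- An affine function which vanishes on a cross edge and is positive above it. -/
def edgeFn (a i : ℕ) : Plane →ᵃ[ℝ] ℝ :=
  affineFn (S.Y a (S.β a i) - S.Y (a + 1) (S.δ a i)) (S.X (a + 1) - S.X a)
    (S.X a * S.Y (a + 1) (S.δ a i) - S.X (a + 1) * S.Y a (S.β a i))

theorem X_lt (a : ℕ) : S.X a < S.X (a + 1) := S.X_strictMono (Nat.lt_succ_self a)

theorem width_pos (a : ℕ) : 0 < S.X (a + 1) - S.X a := sub_pos.2 (S.X_lt a)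

theorem β_le_succ (a i : ℕ) : S.β a i ≤ S.β a (i + 1) := S.β_mono a (Nat.le_succ i)

theorem δ_le_succ (a i : ℕ) : S.δ a i ≤ S.δ a (i + 1) := S.δ_mono a (Nat.le_succ i)

theorem β_succ_le (a i : ℕ) : S.β a (i + 1) ≤ S.β a i + 1 := by
  linarith [S.step a i, S.δ_le_succ a i]

theorem δ_succ_le (a i : ℕ) : S.δ a (i + 1) ≤ S.δ a i + 1 := by
  linarith [S.step a i, S.β_le_succ a i]

theorem edgeFn_west (a i j : ℕ) : S.edgeFn a i (S.west a j)
    = (S.X (a + 1) - S.X a) * (S.Y a (S.β a j) - S.Y a (S.β a i)) := by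
  simp only [edgeFn, affineFn_apply, west_apply_zero, west_apply_one]
  ring

theorem edgeFn_east (a i j : ℕ) : S.edgeFn a i (S.east a j)
    = (S.X (a + 1) - S.X a) * (S.Y (a + 1) (S.δ a j) - S.Y (a + 1) (S.δ a i)) := by
  simp only [edgeFn, affineFn_apply, east_apply_zero, east_apply_one]
  ring

theorem west_ne_east (a i j : ℕ) : S.west a i ≠ S.east a j := fun h =>
  (S.X_lt a).ne (congrArg (fun p : Plane => p 0) h)

theorem affineIndependent_tri (a i : ℕ) : AffineIndependent ℝ ((↑) : S.tri a i → Plane) := by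
  have hstep := S.step a i
  have hβ := S.β_le_succ a i
  have hδ := S.δ_le_succ a i
  have hX := (S.X_lt a).ne
  rcases hβ.eq_or_lt with hβ' | hβ'
  · have hw : S.west a (i + 1) = S.west a i := by rw [west, ← hβ', west]
    have hne : S.east a i ≠ S.east a (i + 1) := fun h =>
      (S.Y_strictMono (a + 1) (by lia : S.δ a i < S.δ a (i + 1))).ne
        (congrArg (fun p : Plane => p 1) h)
    refine (affineIndependent_triple (affineFn 1 0 0) (r := S.west a i) hne (by simp)
      (by simpa using hX)).mono (s := (S.tri a i : Set Plane)) fun v hv => ?_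
    rcases S.mem_tri.1 hv with rfl | rfl | rfl | rfl <;> simp [hw]
  · have he : S.east a (i + 1) = S.east a i := by
      rw [east, (by lia : S.δ a (i + 1) = S.δ a i), east]
    have hne : S.west a i ≠ S.west a (i + 1) := fun h =>
      (S.Y_strictMono a hβ').ne (congrArg (fun p : Plane => p 1) h)
    refine (affineIndependent_triple (affineFn 1 0 0) (r := S.east a i) hne (by simp)
      (by simpa using hX.symm)).mono (s := (S.tri a i : Set Plane)) fun v hv => ?_
    rcases S.mem_tri.1 hv with rfl | rfl | rfl | rfl <;> simp [he]

theorem edgeFn_nonpos_of_mem_tri {a i j : ℕ} (hij : i < j) {v : Plane} (hv : v ∈ S.tri a i) :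
    S.edgeFn a j v ≤ 0 := by
  rcases S.mem_tri.1 hv with rfl | rfl | rfl | rfl <;>
  simp only [edgeFn_west, edgeFn_east] <;>
  refine mul_nonpos_of_nonneg_of_nonpos (S.width_pos a).le (sub_nonpos.2 ?_) <;>
  refine (S.Y_strictMono _).monotone ?_ <;> first | apply S.β_mono | apply S.δ_mono
  all_goals lia

theorem edgeFn_nonneg_of_mem_tri {a i j : ℕ} (hji : j ≤ i) {v : Plane} (hv : v ∈ S.tri a i) :
    0 ≤ S.edgeFn a j v := by
  rcases S.mem_tri.1 hv with rfl | rfl | rfl | rfl <;>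
  simp only [edgeFn_west, edgeFn_east] <;>
  refine mul_nonneg (S.width_pos a).le (sub_nonneg.2 ?_) <;>
  refine (S.Y_strictMono _).monotone ?_ <;> first | apply S.β_mono | apply S.δ_mono
  all_goals lia

theorem mem_pair_of_edgeFn_eq_zero {a i j : ℕ} {v : Plane} (hv : v ∈ S.tri a i)
    (h : S.edgeFn a j v = 0) : v ∈ ({S.west a j, S.east a j} : Set Plane) := by
  rcases S.mem_tri.1 hv with rfl | rfl | rfl | rfl <;>
  simp only [edgeFn_west, edgeFn_east, mul_eq_zero, (S.width_pos a).ne', false_or,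
    sub_eq_zero] at h
  · exact .inl (plane_ext rfl h)
  · exact .inl (plane_ext rfl h)
  · exact .inr (plane_ext rfl h)
  · exact .inr (plane_ext rfl h)

theorem conformal_tri_of_lt (a : ℕ) {i j : ℕ} (hij : i < j) :
    Conformal (S.tri a i) (S.tri a j) := by
  refine conformal_of_separated (S.edgeFn a j) (fun v => S.edgeFn_nonpos_of_mem_tri hij)
    (fun v => S.edgeFn_nonneg_of_mem_tri le_rfl)
    (conformal_of_affineIndependent (affineIndependent_pair (S.west_ne_east a j j)) ?_ ?_)
  all_goals exact fun v hv =>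
    S.mem_pair_of_edgeFn_eq_zero (Finset.mem_filter.1 hv).1 (Finset.mem_filter.1 hv).2

theorem eq_east_of_mem_tri {a i : ℕ} {v : Plane} (hv : v ∈ S.tri a i) (h : v 0 = S.X (a + 1)) :
    v ∈ ({S.east a i, S.east a (i + 1)} : Set Plane) := by
  rcases S.mem_tri.1 hv with rfl | rfl | hv | hv
  exacts [((S.X_lt a).ne h).elim, ((S.X_lt a).ne h).elim, .inl hv, .inr hv]

theorem eq_west_of_mem_tri {a i : ℕ} {v : Plane} (hv : v ∈ S.tri a i) (h : v 0 = S.X a) :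
    v ∈ ({S.west a i, S.west a (i + 1)} : Set Plane) := by
  rcases S.mem_tri.1 hv with hv | hv | rfl | rfl
  exacts [.inl hv, .inr hv, ((S.X_lt a).ne' h).elim, ((S.X_lt a).ne' h).elim]

theorem mem_Icc_of_mem_tri {a i : ℕ} {v : Plane} (hv : v ∈ S.tri a i) :
    v 0 ∈ Set.Icc (S.X a) (S.X (a + 1)) := by
  rcases S.mem_tri.1 hv with rfl | rfl | rfl | rfl <;> simp [(S.X_lt a).le]

theorem conformal_tri_of_strip_lt {a a' : ℕ} (h : a < a') (i j : ℕ) :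
    Conformal (S.tri a i) (S.tri a' j) := by
  have hle : S.X (a + 1) ≤ S.X a' := S.X_strictMono.monotone h
  have hzero : ∀ v, affineFn 1 0 (-S.X (a + 1)) v = 0 → v 0 = S.X (a + 1) := fun v hv => by
    simpa [add_neg_eq_zero] using hv
  refine conformal_of_separated (affineFn 1 0 (-S.X (a + 1)))
    (fun v hv => by simpa using (S.mem_Icc_of_mem_tri hv).2)
    (fun v hv => by simpa using hle.trans (S.mem_Icc_of_mem_tri hv).1) ?_
  rcases (Nat.succ_le_of_lt h).eq_or_lt with rfl | hlt
  · refine conformal_of_subset_column (S.X (a + 1)) (S.Y_strictMono (a + 1)) (S.δ_le_succ a i)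
      (S.δ_succ_le a i) (S.β_le_succ (a + 1) j) (S.β_succ_le (a + 1) j) (fun v hv => ?_)
      fun v hv => ?_ <;> obtain ⟨hv, h0⟩ := Finset.mem_filter.1 hv
    · exact S.eq_east_of_mem_tri hv (hzero v h0)
    · exact S.eq_west_of_mem_tri hv (hzero v h0)
  · have hempty : (S.tri a' j).filter (fun v => affineFn 1 0 (-S.X (a + 1)) v = 0) = ∅ :=
      Finset.filter_eq_empty_iff.2 fun v hv h0 =>
        ((S.X_strictMono hlt).trans_le (S.mem_Icc_of_mem_tri hv).1).ne' (hzero v h0)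
    rw [hempty, Conformal, Finset.coe_empty, convexHull_empty, Set.inter_empty]
    exact Set.empty_subset _

/-- The triangles of all strips. -/
def family : Set (Finset Plane) := {t | ∃ a < S.numStrips, ∃ i < S.len a, t = S.tri a i}

theorem conformal_family : ∀ s ∈ S.family, ∀ t ∈ S.family, Conformal s t := by
  rintro _ ⟨a, -, i, -, rfl⟩ _ ⟨b, -, j, -, rfl⟩
  rcases lt_trichotomy a b with h | rfl | h
  · exact S.conformal_tri_of_strip_lt h i j
  · rcases lt_trichotomy i j with h | rfl | h
    · exact S.conformal_tri_of_lt a h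
    · exact conformal_of_affineIndependent (S.affineIndependent_tri a i) subset_rfl subset_rfl
    · exact (S.conformal_tri_of_lt a h).symm
  · exact (S.conformal_tri_of_strip_lt h j i).symm

/-- The triangulation given by the strips. -/
def complex : Geometry.SimplicialComplex ℝ Plane :=
  complexOfFamily S.family (by rintro _ ⟨a, -, i, -, rfl⟩; exact S.affineIndependent_tri a i)
    S.conformal_family

theorem tri_mem_faces {a i : ℕ} (ha : a < S.numStrips) (hi : i < S.len a) :
    S.tri a i ∈ S.complex.faces :=
  ⟨⟨S.west a i, S.mem_tri.2 (.inl rfl)⟩, S.tri a i, ⟨a, ha, i, hi, rfl⟩, subset_rfl⟩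

theorem finite_faces : S.complex.faces.Finite := by
  have h : S.complex.faces ⊆ ⋃ a ∈ Finset.range S.numStrips, ⋃ i ∈ Finset.range (S.len a),
      ((S.tri a i).powerset : Set (Finset Plane)) := by
    rintro s ⟨-, _, ⟨a, ha, i, hi, rfl⟩, hs⟩
    simp only [Set.mem_iUnion]
    exact ⟨a, Finset.mem_range.2 ha, i, Finset.mem_range.2 hi,
      Finset.mem_coe.2 (Finset.mem_powerset.2 hs)⟩
  exact (Set.Finite.biUnion (Finset.finite_toSet _) fun a _ =>
    Set.Finite.biUnion (Finset.finite_toSet _) fun i _ => Finset.finite_toSet _).subset h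

theorem exists_of_mem_vertices {v : Plane} (hv : v ∈ S.complex.vertices) :
    ∃ a < S.numStrips, ∃ i ≤ S.len a, v = S.west a i ∨ v = S.east a i := by
  obtain ⟨-, _, ⟨a, ha, i, hi, rfl⟩, hs⟩ := hv
  rcases S.mem_tri.1 (hs (Finset.mem_singleton_self v)) with h | h | h | h
  exacts [⟨a, ha, i, hi.le, .inl h⟩, ⟨a, ha, i + 1, hi, .inl h⟩, ⟨a, ha, i, hi.le, .inr h⟩,
    ⟨a, ha, i + 1, hi, .inr h⟩]

/-- The point of a cross edge at a given fraction of the way from west to east. -/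
def crossPoint (a i : ℕ) (u : ℝ) : Plane := AffineMap.lineMap (S.west a i) (S.east a i) u

theorem crossPoint_apply_zero (a i : ℕ) (u : ℝ) :
    S.crossPoint a i u 0 = AffineMap.lineMap (S.X a) (S.X (a + 1)) u := by
  simp [crossPoint, AffineMap.lineMap_apply]

theorem crossPoint_apply_one (a i : ℕ) (u : ℝ) :
    S.crossPoint a i u 1 = AffineMap.lineMap (S.Y a (S.β a i)) (S.Y (a + 1) (S.δ a i)) u := by
  simp [crossPoint, AffineMap.lineMap_apply]

theorem crossPoint_mem_convexHull_tri {a i l : ℕ} (hl : l = i ∨ l = i + 1) {u : ℝ}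
    (hu : u ∈ Set.Icc (0 : ℝ) 1) : S.crossPoint a l u ∈ convexHull ℝ (S.tri a i : Set Plane) := by
  refine segment_subset_convexHull (x := S.west a l) (y := S.east a l) ?_ ?_
    (lineMap_mem_segment ℝ _ _ hu) <;>
  rcases hl with rfl | rfl <;> simp [mem_tri]

theorem edgeFn_eq_mul_sub (a i : ℕ) {u : ℝ} {p : Plane} (hp : p 0 = S.crossPoint a i u 0) :
    S.edgeFn a i p = (S.X (a + 1) - S.X a) * (p 1 - S.crossPoint a i u 1) := by
  rw [crossPoint_apply_zero, AffineMap.lineMap_apply_ring'] at hp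
  rw [crossPoint_apply_one, AffineMap.lineMap_apply_ring', edgeFn, affineFn_apply, hp]
  ring

theorem exists_mem_convexHull_tri {a i₁ i₂ : ℕ} {p : Plane}
    (hp : p 0 ∈ Set.Icc (S.X a) (S.X (a + 1))) (hlt : i₁ < i₂) (h₁ : 0 ≤ S.edgeFn a i₁ p)
    (h₂ : S.edgeFn a i₂ p ≤ 0) :
    ∃ i, i₁ ≤ i ∧ i < i₂ ∧ p ∈ convexHull ℝ (S.tri a i : Set Plane) := by
  obtain ⟨i, hi₁, hi₂, hlo, hhi⟩ := exists_sign_change (fun i => S.edgeFn a i p) hlt h₁ h₂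
  obtain ⟨u, hu, hup⟩ :
      ∃ u ∈ Set.Icc (0 : ℝ) 1, AffineMap.lineMap (S.X a) (S.X (a + 1)) u = p 0 := by
    rwa [← segment_eq_Icc (S.X_lt a).le, segment_eq_image_lineMap] at hp
  have hx : ∀ l, S.crossPoint a l u 0 = p 0 := fun l => (S.crossPoint_apply_zero a l u).trans hup
  rw [S.edgeFn_eq_mul_sub a _ (hx _).symm] at hlo hhi
  refine ⟨i, hi₁, hi₂, (convex_convexHull ℝ _).segment_subset
    (S.crossPoint_mem_convexHull_tri (.inl rfl) hu) (S.crossPoint_mem_convexHull_tri (.inr rfl) hu)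
    (mem_segment_of_vertical (hx _) (hx _) ?_ ?_)⟩
  · exact sub_nonneg.1 (nonneg_of_mul_nonneg_right hlo (S.width_pos a))
  · exact sub_nonpos.1 (nonpos_of_mul_nonpos_right hhi (S.width_pos a))

theorem edgeFn_zero_nonneg (a : ℕ) {p : Plane} (hp : p ∈ unitSquare) : 0 ≤ S.edgeFn a 0 p := by
  simp only [edgeFn, S.β_zero, S.δ_zero, S.Y_zero, affineFn_apply]
  linarith [mul_nonneg (S.width_pos a).le (hp 1).1]

theorem edgeFn_len_nonpos {a : ℕ} (ha : a < S.numStrips) {p : Plane} (hp : p ∈ unitSquare) :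
    S.edgeFn a (S.len a) p ≤ 0 := by
  simp only [edgeFn, S.Y_β_len a ha, S.Y_δ_len a ha, affineFn_apply]
  linarith [mul_nonneg (S.width_pos a).le (sub_nonneg.2 (hp 1).2)]

theorem len_pos {a : ℕ} (ha : a < S.numStrips) : 0 < S.len a := by
  refine Nat.pos_of_ne_zero fun h => ?_
  have hlen := S.Y_β_len a ha
  rw [h, S.β_zero, S.Y_zero] at hlen
  exact zero_ne_one hlen

theorem exists_tri_of_mem_strip {a : ℕ} (ha : a < S.numStrips) {p : Plane} (hp : p ∈ unitSquare)
    (hpa : p 0 ∈ Set.Icc (S.X a) (S.X (a + 1))) :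
    ∃ i < S.len a, p ∈ convexHull ℝ (S.tri a i : Set Plane) := by
  obtain ⟨i, -, hi, h⟩ := S.exists_mem_convexHull_tri hpa (S.len_pos ha)
    (S.edgeFn_zero_nonneg a hp) (S.edgeFn_len_nonpos ha hp)
  exact ⟨i, hi, h⟩

theorem exists_strip_of_mem {p : Plane} (hp : p ∈ unitSquare) :
    ∃ a < S.numStrips, p 0 ∈ Set.Icc (S.X a) (S.X (a + 1)) := by
  have hpos : 0 < S.numStrips := Nat.pos_of_ne_zero fun h =>
    zero_ne_one (S.X_zero.symm.trans (h ▸ S.X_last))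
  obtain ⟨a, -, ha, hlo, hhi⟩ := exists_sign_change (fun a => p 0 - S.X a) hpos
    (by simpa [S.X_zero] using (hp 0).1) (by simpa [S.X_last] using (hp 0).2)
  exact ⟨a, ha, sub_nonneg.1 hlo, sub_nonpos.1 hhi⟩

theorem tri_subset_unitSquare {a i : ℕ} (ha : a < S.numStrips) (hi : i < S.len a) :
    (S.tri a i : Set Plane) ⊆ unitSquare := by
  have hX : ∀ b ≤ S.numStrips, S.X b ∈ Set.Icc (0 : ℝ) 1 := fun b hb =>
    ⟨S.X_zero ▸ S.X_strictMono.monotone (Nat.zero_le b), S.X_last ▸ S.X_strictMono.monotone hb⟩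
  have hw : ∀ l ≤ S.len a, S.west a l ∈ rect (Set.Icc 0 1) (Set.Icc 0 1) := fun l hl =>
    ⟨hX a ha.le, S.Y_zero a ▸ (S.Y_strictMono a).monotone (Nat.zero_le _),
      S.Y_β_len a ha ▸ (S.Y_strictMono a).monotone (S.β_mono a hl)⟩
  have he : ∀ l ≤ S.len a, S.east a l ∈ rect (Set.Icc 0 1) (Set.Icc 0 1) := fun l hl =>
    ⟨hX _ ha, S.Y_zero (a + 1) ▸ (S.Y_strictMono (a + 1)).monotone (Nat.zero_le _),
      S.Y_δ_len a ha ▸ (S.Y_strictMono (a + 1)).monotone (S.δ_mono a hl)⟩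
  rw [unitSquare_eq_rect]
  intro v hv
  rcases S.mem_tri.1 hv with rfl | rfl | rfl | rfl
  exacts [hw _ hi.le, hw _ hi, he _ hi.le, he _ hi]

theorem space_complex : S.complex.space = unitSquare := by
  refine Set.Subset.antisymm (fun p hp => ?_) fun p hp => ?_
  · obtain ⟨s, ⟨-, _, ⟨a, ha, i, hi, rfl⟩, hs⟩, hps⟩ :=
      Geometry.SimplicialComplex.mem_space_iff.1 hp
    exact convexHull_min (S.tri_subset_unitSquare ha hi) convex_unitSquare
      (convexHull_mono (Finset.coe_subset.2 hs) hps)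
  · obtain ⟨a, ha, hpa⟩ := S.exists_strip_of_mem hp
    obtain ⟨i, hi, hpi⟩ := S.exists_tri_of_mem_strip ha hp hpa
    exact Geometry.SimplicialComplex.mem_space_iff.2 ⟨_, S.tri_mem_faces ha hi, hpi⟩

/-- The terrain `T` is triangulated by the strips of `S`, and its height interpolates the values
of `f` at the vertices. -/
def Interpolates (T : Terrain) (f : Plane → ℝ) : Prop :=
  T.triangulation = S.complex ∧ ∀ a < S.numStrips, ∀ i < S.len a, ∃ A : Plane →ᵃ[ℝ] ℝ,
    Set.EqOn A f (S.tri a i) ∧ Set.EqOn T.height A (convexHull ℝ (S.tri a i : Set Plane))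

theorem exists_interpolates (f : Plane → ℝ) : ∃ T : Terrain, S.Interpolates T f := by
  obtain ⟨H, hH⟩ := exists_interpolation S.complex f
  exact ⟨⟨S.complex, S.finite_faces, S.space_complex, H, fun s hs =>
    (hH s hs).imp fun A hA => hA.2⟩, rfl, fun a ha i hi => hH _ (S.tri_mem_faces ha hi)⟩

variable {S} {T : Terrain} {f : Plane → ℝ}

theorem Interpolates.height_mem (hT : S.Interpolates T f) {a i : ℕ} (ha : a < S.numStrips)
    (hi : i < S.len a) {I : Set ℝ} (hI : Convex ℝ I) (hf : ∀ v ∈ S.tri a i, f v ∈ I) {p : Plane}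
    (hp : p ∈ convexHull ℝ (S.tri a i : Set Plane)) : T.height p ∈ I := by
  obtain ⟨A, hAf, hAT⟩ := hT.2 a ha i hi
  rw [hAT hp]
  exact affineMap_mem_of_mem_convexHull A hI (fun v hv => hAf hv ▸ hf v hv) hp

theorem Interpolates.height_eq_of_strip (hT : S.Interpolates T f) {a : ℕ} (ha : a < S.numStrips)
    (B : Plane →ᵃ[ℝ] ℝ) (hB : ∀ v : Plane, v 0 = S.X a ∨ v 0 = S.X (a + 1) → f v = B v) {p : Plane}
    (hp : p ∈ unitSquare) (hpa : p 0 ∈ Set.Icc (S.X a) (S.X (a + 1))) : T.height p = B p := by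
  obtain ⟨i, hi, hpi⟩ := S.exists_tri_of_mem_strip ha hp hpa
  obtain ⟨A, hAf, hAT⟩ := hT.2 a ha i hi
  rw [hAT hpi]
  refine eqOn_convexHull (fun v hv => (hAf hv).trans (hB v ?_)) hpi
  rcases S.mem_tri.1 hv with rfl | rfl | rfl | rfl <;> simp

end StripSystem

theorem ridgesWidth_pos {c : ℝ} (hc : 0 < c) (n : ℕ) : 0 < ridgesWidth c n := by
  unfold ridgesWidth; positivity

theorem ridgeLine_zero (c : ℝ) (n : ℕ) : ridgeLine c n 0 = ridgesWest c n := by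
  simp [ridgeLine]

theorem ridgeLine_last (c : ℝ) {n : ℕ} (hn : 1 ≤ n) : ridgeLine c n (2 * n) = 1 := by
  have hn0 : (n : ℝ) ≠ 0 := by positivity
  simp only [ridgeLine, ridgesWest]
  push_cast
  field_simp
  ring

theorem ridgeLine_succ (c : ℝ) (n j : ℕ) :
    ridgeLine c n (j + 1) = ridgeLine c n j + ridgesWidth c n / (2 * n) := by
  simp only [ridgeLine]; push_cast; ring

theorem ridgeLine_strictMono {c : ℝ} (hc : 0 < c) {n : ℕ} (hn : 1 ≤ n) :
    StrictMono (ridgeLine c n) := by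
  refine strictMono_nat_of_lt_succ fun j => ?_
  rw [ridgeLine_succ]
  have hwidth := ridgesWidth_pos hc n
  exact lt_add_of_pos_right _ (by positivity)

theorem ridgesWest_le_ridgeLine {c : ℝ} (hc : 0 < c) {n : ℕ} (hn : 1 ≤ n) (j : ℕ) :
    ridgesWest c n ≤ ridgeLine c n j :=
  (ridgeLine_zero c n).ge.trans ((ridgeLine_strictMono hc hn).monotone (Nat.zero_le j))

theorem ridgesWest_lt_one {c : ℝ} (hc : 0 < c) (n : ℕ) : ridgesWest c n < 1 :=
  sub_lt_self 1 (ridgesWidth_pos hc n)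

theorem farmSide_le_farmSouth {c : ℝ} {m k i : ℕ} (hs : 0 < farmSide c m)
    (hk : 3 * k * farmSide c m ≤ 1) (hi : i < k) : farmSide c m ≤ farmSouth c m i := by
  have hik : (i : ℝ) + 1 ≤ k := by exact_mod_cast hi
  unfold farmSouth
  nlinarith

theorem farmSouth_add_le_one {c : ℝ} {m : ℕ} (hs : 0 < farmSide c m) (i : ℕ) :
    farmSouth c m i + 2 * farmSide c m ≤ 1 := by
  unfold farmSouth
  nlinarith [Nat.cast_nonneg (α := ℝ) i]

/-- A subdivision `0 = y 0 < … < y N = 1` of the unit interval. The values of `y` beyond `N` are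
irrelevant; they continue the sequence strictly monotonically. -/
structure Subdivision where
  y : ℕ → ℝ
  N : ℕ
  strictMono : StrictMono y
  y_zero : y 0 = 0
  y_last : y N = 1

theorem exists_subdivision (L : Finset ℝ) (hL : ∀ x ∈ L, x ∈ Set.Icc (0 : ℝ) 1) :
    ∃ D : Subdivision, D.N + 1 ≤ L.card + 2 ∧ ∀ x ∈ L, x ∈ Set.range D.y := by
  let M : Finset ℝ := insert 0 (insert 1 L)
  have hM : ∀ x ∈ M, x ∈ Set.Icc (0 : ℝ) 1 := by simpa [M] using hL
  have hpos : 0 < M.card := Finset.card_pos.2 ⟨0, Finset.mem_insert_self _ _⟩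
  let g := M.orderEmbOfFin rfl
  have hg : ∀ b, g b ∈ Set.Icc (0 : ℝ) 1 := fun b => hM _ (M.orderEmbOfFin_mem rfl b)
  let y : ℕ → ℝ := fun b => if hb : b < M.card then g ⟨b, hb⟩ else 1 + b
  have hy : StrictMono y := by
    refine strictMono_nat_of_lt_succ fun b => ?_
    by_cases hb : b + 1 < M.card
    · simp only [y, hb, (Nat.lt_succ_self b).trans hb, dif_pos]
      exact g.strictMono (Nat.lt_succ_self b)
    · have hle : y b ≤ 1 + b := by
        simp only [y]
        split_ifs with hb'
        · linarith [(hg ⟨b, hb'⟩).2, Nat.cast_nonneg (α := ℝ) b]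
        · rfl
      simp only [y, hb, dif_neg, not_false_eq_true] at hle ⊢
      push_cast
      linarith
  have hmem : ∀ b < M.card, y b ∈ Set.Icc (0 : ℝ) 1 := fun b hb => by
    simp only [y, hb, dif_pos]
    exact hg _
  have hsurj : ∀ x ∈ M, ∃ b ≤ M.card - 1, y b = x := by
    intro x hx
    obtain ⟨b, rfl⟩ : x ∈ Set.range g := by rwa [Finset.range_orderEmbOfFin]
    exact ⟨b, Nat.le_pred_of_lt b.2, by simp only [y, b.2, dif_pos]⟩
  refine ⟨⟨y, M.card - 1, hy, ?_, ?_⟩, ?_, fun x hx => ?_⟩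
  · obtain ⟨b, -, hb⟩ := hsurj 0 (by simp [M])
    exact le_antisymm (hb ▸ hy.monotone (Nat.zero_le b)) (hmem 0 hpos).1
  · obtain ⟨b, hbM, hb⟩ := hsurj 1 (by simp [M])
    exact le_antisymm (hmem _ (Nat.sub_lt hpos one_pos)).2 (hb ▸ hy.monotone hbM)
  · rw [Nat.sub_add_cancel hpos]
    exact (Finset.card_insert_le _ _).trans (Nat.succ_le_succ (Finset.card_insert_le _ _))
  · obtain ⟨b, -, hb⟩ := hsurj x (by simp [M, hx])
    exact ⟨b, hb⟩

theorem succ_le_of_lt_mem_range {x : ℕ → ℝ} (hx : StrictMono x) {u : ℝ} (hu : u ∈ Set.range x)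
    {a : ℕ} (h : x a < u) : x (a + 1) ≤ u := by
  obtain ⟨b, rfl⟩ := hu
  exact hx.monotone (Nat.succ_le_of_lt (hx.lt_iff_lt.1 h))

theorem le_of_mem_range_lt_succ {x : ℕ → ℝ} (hx : StrictMono x) {u : ℝ} (hu : u ∈ Set.range x)
    {a : ℕ} (h : u < x (a + 1)) : u ≤ x a := by
  obtain ⟨b, rfl⟩ := hu
  exact hx.monotone (Nat.le_of_lt_succ (hx.lt_iff_lt.1 h))

namespace Subdivision

variable (D : Subdivision) (g r : ℕ) (x : ℕ → ℝ) (hx : StrictMono x) (hx0 : x 0 = 0)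
  (hx1 : x (r + g) = 1)

/-- The triangulation of the unit square with the columns `x 0, …, x (r + g)` that consists of a
grid, subdivided at the levels of `D`, on the first `g` strips, of a fan with apex on the south
wall on the next strip, and of two triangles on each of the last strips. -/
def gridFan : StripSystem where
  numStrips := r + g
  X := x
  Y a b := if a ≤ g then D.y b else b
  β a i := if a = g then min i D.N else i / 2
  δ a i := if a = g then i - D.N else (i + 1) / 2
  len a := if a < g then 2 * D.N else if a = g then D.N + 1 else 2
  X_strictMono := hx
  Y_strictMono a := by
    split_ifs
    exacts [D.strictMono, Nat.strictMono_cast]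
  X_zero := hx0
  X_last := hx1
  β_zero a := by split_ifs <;> simp
  δ_zero a := by split_ifs <;> simp
  β_mono a i j h := by dsimp only; split_ifs <;> omega
  δ_mono a i j h := by dsimp only; split_ifs <;> omega
  step a i := by split_ifs <;> omega
  Y_zero a := by split_ifs <;> simp [D.y_zero]
  Y_β_len a _ := by
    rcases lt_trichotomy a g with h | rfl | h
    · simp [h, h.le, h.ne, D.y_last]
    · simp [D.y_last]
    · simp [not_le.2 h, h.not_gt, h.ne']
  Y_δ_len a _ := by
    rcases lt_trichotomy a g with h | rfl | h
    · simp [h, Nat.succ_le_of_lt h, h.ne, (by omega : (2 * D.N + 1) / 2 = D.N), D.y_last]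
    · simp
    · simp [h.not_gt, h.ne']

/-- A rectangle of the grid with the columns `x` and the levels of `D`. -/
def gridCell (a b : ℕ) : Set Plane :=
  rect (Set.Icc (x a) (x (a + 1))) (Set.Icc (D.y b) (D.y (b + 1)))

include hx0 in
theorem exists_mem_gridCell {g : ℕ} (hg : 0 < g) {p : Plane} (hp : p ∈ unitSquare)
    (hpg : p 0 ≤ x g) : ∃ a < g, ∃ b < D.N, p ∈ D.gridCell x a b := by
  have hN : 0 < D.N := Nat.pos_of_ne_zero fun h => zero_ne_one (D.y_zero.symm.trans (h ▸ D.y_last))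
  obtain ⟨a, -, ha, hlo, hhi⟩ := exists_sign_change (fun a => p 0 - x a) hg
    (by simpa [hx0] using (hp 0).1) (sub_nonpos.2 hpg)
  obtain ⟨b, -, hb, hlo', hhi'⟩ := exists_sign_change (fun b => p 1 - D.y b) hN
    (by simpa [D.y_zero] using (hp 1).1) (by simpa [D.y_last] using (hp 1).2)
  exact ⟨a, ha, b, hb, ⟨sub_nonneg.1 hlo, sub_nonpos.1 hhi⟩, sub_nonneg.1 hlo', sub_nonpos.1 hhi'⟩

variable {g r x hx hx0 hx1}

theorem edgeFn_gridFan {a : ℕ} (ha : a < g) (b : ℕ) (p : Plane) :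
    (D.gridFan g r x hx hx0 hx1).edgeFn a (2 * b) p = (x (a + 1) - x a) * (p 1 - D.y b) := by
  simp only [StripSystem.edgeFn, gridFan, ha.ne, ha.le, Nat.succ_le_of_lt ha, if_true, if_false,
    affineFn_apply, (by omega : 2 * b / 2 = b), (by omega : (2 * b + 1) / 2 = b)]
  ring

theorem tri_gridFan_subset_gridCell {a i b : ℕ} (ha : a < g) (hib : 2 * b ≤ i)
    (hib' : i < 2 * (b + 1)) :
    ((D.gridFan g r x hx hx0 hx1).tri a i : Set Plane) ⊆ D.gridCell x a b := by
  have hy := D.strictMono.monotone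
  have hlevel : ∀ l, b ≤ l → l ≤ b + 1 → D.y l ∈ Set.Icc (D.y b) (D.y (b + 1)) :=
    fun l hl hl' => ⟨hy hl, hy hl'⟩
  intro v hv
  refine ⟨StripSystem.mem_Icc_of_mem_tri _ hv, ?_⟩
  rcases (StripSystem.mem_tri _).1 hv with rfl | rfl | rfl | rfl <;>
  simp only [StripSystem.west_apply_one, StripSystem.east_apply_one, gridFan, ha.ne, ha.le,
    Nat.succ_le_of_lt ha, if_true, if_false] <;>
  exact hlevel _ (by omega) (by omega)

theorem height_mem_of_mem_gridCell {T : Terrain} {f : Plane → ℝ}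
    (hT : (D.gridFan g r x hx hx0 hx1).Interpolates T f) {a b : ℕ} (ha : a < g) (hb : b < D.N)
    {I : Set ℝ} (hI : Convex ℝ I) (hf : ∀ v ∈ D.gridCell x a b, f v ∈ I) {p : Plane}
    (hp : p ∈ D.gridCell x a b) : T.height p ∈ I := by
  have hX := sub_nonneg.2 (hx.monotone (Nat.le_succ a))
  obtain ⟨i, hi, hi', hpi⟩ := (D.gridFan g r x hx hx0 hx1).exists_mem_convexHull_tri
    (i₁ := 2 * b) (i₂ := 2 * (b + 1)) hp.1 (by lia)
    (by rw [D.edgeFn_gridFan ha]; exact mul_nonneg hX (sub_nonneg.2 hp.2.1))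
    (by
      rw [D.edgeFn_gridFan ha]
      exact mul_nonpos_of_nonneg_of_nonpos hX (sub_nonpos.2 hp.2.2))
  have hlen : i < (D.gridFan g r x hx hx0 hx1).len a := by
    simp only [gridFan, if_pos ha]
    lia
  exact hT.height_mem (ha.trans_le (Nat.le_add_left g r)) hlen hI
    (fun v hv => hf v (D.tri_gridFan_subset_gridCell ha hi hi' hv)) hpi

theorem ncard_vertices_gridFan_le :
    (D.gridFan g r x hx hx0 hx1).complex.vertices.ncard ≤ (g + 1) * (D.N + 1) + 2 * r := by
  let S := D.gridFan g r x hx hx0 hx1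
  let I : Finset (ℕ × ℕ) := Finset.range (g + 1) ×ˢ Finset.range (D.N + 1)
    ∪ Finset.Ico (g + 1) (g + 1 + r) ×ˢ Finset.range 2
  have hsub : S.complex.vertices ⊆ (fun ab : ℕ × ℕ => pt (S.X ab.1) (S.Y ab.1 ab.2)) '' I := by
    intro v hv
    obtain ⟨a, ha, i, hi, hvi⟩ := S.exists_of_mem_vertices hv
    have hmem : (a, S.β a i) ∈ I ∧ (a + 1, S.δ a i) ∈ I := by
      simp only [I, Finset.mem_union, Finset.mem_product, Finset.mem_range, Finset.mem_Ico]
      simp only [S, gridFan] at ha hi ⊢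
      split_ifs at hi ⊢ <;> omega
    rcases hvi with rfl | rfl
    exacts [⟨_, hmem.1, rfl⟩, ⟨_, hmem.2, rfl⟩]
  calc S.complex.vertices.ncard
      ≤ ((fun ab : ℕ × ℕ => pt (S.X ab.1) (S.Y ab.1 ab.2)) '' I).ncard :=
        Set.ncard_le_ncard hsub (I.finite_toSet.image _)
    _ ≤ I.card := (Set.ncard_image_le I.finite_toSet).trans_eq (Set.ncard_coe_finset I)
    _ ≤ (g + 1) * (D.N + 1) + 2 * r := by
        refine (Finset.card_union_le _ _).trans_eq ?_
        simp only [Finset.card_product, Finset.card_range, Nat.card_Ico]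
        lia

end Subdivision

/-- Parameters for which the farms, the roads and the ridges, each with a surrounding boundary
region, fit into the unit square. -/
structure Layout (c : ℝ) (n m k : ℕ) (ω ε : ℝ) : Prop where
  c_pos : 0 < c
  one_le_n : 1 ≤ n
  side_pos : 0 < farmSide c m
  fit : 3 * k * farmSide c m ≤ 1
  ω_nonneg : 0 ≤ ω
  ε_pos : 0 < ε
  ω_lt : ω + 3 * ε < farmSide c m
  gap : farmSide c m + 3 * ε < ridgesWest c n

theorem farm_union_road_subset_builtArea {c : ℝ} {n m k : ℕ} {ω : ℝ} {i : ℕ} (hi : i < k) :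
    farm c m i ∪ road c n m ω i ⊆ builtArea c n m k ω :=
  fun _ hp => .inl (Set.mem_iUnion₂.2 ⟨i, hi, hp⟩)

theorem Layout.farm_union_road_subset_unitSquare {c : ℝ} {n m k : ℕ} {ω ε : ℝ}
    (hL : Layout c n m k ω ε) {i : ℕ} (hi : i < k) :
    farm c m i ∪ road c n m ω i ⊆ unitSquare := by
  have hS := farmSide_le_farmSouth hL.side_pos hL.fit hi
  have hS' := farmSouth_add_le_one hL.side_pos i
  have hW := ridgesWest_lt_one hL.c_pos n
  have hω := hL.ω_nonneg
  have hωs := hL.ω_lt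
  have hε := hL.ε_pos
  rw [unitSquare_eq_rect]
  rintro p (⟨⟨hl, hu⟩, hl', hu'⟩ | ⟨⟨hl, hu⟩, hl', hu'⟩) <;>
  exact ⟨⟨by linarith, by linarith⟩, by linarith, by linarith⟩

theorem dist_le_abs_add_abs (p q : Plane) : dist p q ≤ |p 0 - q 0| + |p 1 - q 1| := by
  rw [EuclideanSpace.dist_eq, Fin.sum_univ_two, Real.dist_eq, Real.dist_eq]
  refine Real.sqrt_le_iff.2 ⟨by positivity, ?_⟩
  nlinarith [mul_nonneg (abs_nonneg (p 0 - q 0)) (abs_nonneg (p 1 - q 1))]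

theorem exists_mem_Icc_abs_sub_le {l u t z : ℝ} (hlu : l ≤ u) (ht : 0 ≤ t)
    (hz : z ∈ Set.Icc (l - t) (u + t)) : ∃ w ∈ Set.Icc l u, |z - w| ≤ t := by
  obtain ⟨hl, hu⟩ := hz
  rcases le_total z l with h | h
  · exact ⟨l, ⟨le_rfl, hlu⟩, abs_le.2 ⟨by linarith, by linarith⟩⟩
  rcases le_total u z with h' | h'
  · exact ⟨u, ⟨hlu, le_rfl⟩, abs_le.2 ⟨by linarith, by linarith⟩⟩
  · exact ⟨z, ⟨h, h'⟩, by simpa using ht⟩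

/-- The columns of the triangulation of a farming terrain with boundary regions of
width `5 * d`. -/
def columnX (c : ℝ) (n m : ℕ) (d : ℝ) : ℕ → ℝ
  | 0 => 0
  | 1 => farmSide c m + d
  | 2 => farmSide c m + 2 * d
  | 3 => ridgesWest c n - d
  | j + 4 => ridgeLine c n j

theorem columnX_four (c : ℝ) (n m : ℕ) (d : ℝ) : columnX c n m d 4 = ridgesWest c n :=
  ridgeLine_zero c n

/-- The farm `i` and its road, enlarged by `t`; also the points west of the square are included. -/
def margin (c : ℝ) (n m : ℕ) (ω t : ℝ) (i : ℕ) : Set Plane :=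
  rect (Set.Iic (farmSide c m + t))
      (Set.Icc (farmSouth c m i - t) (farmSouth c m i + farmSide c m + t)) ∪
    rect (Set.Iic (ridgesWest c n)) (Set.Icc (farmSouth c m i - t) (farmSouth c m i + ω + t))

/-- The levels at which a subdivision resolves the set `margin c n m ω t i`. -/
def marginLevels (c : ℝ) (m : ℕ) (ω t : ℝ) (i : ℕ) : Finset ℝ :=
  {farmSouth c m i - t, farmSouth c m i + farmSide c m + t, farmSouth c m i + ω + t}

/-- The levels of the triangulation of a farming terrain with boundary regions of
width `5 * d`. -/
def levels (c : ℝ) (m k : ℕ) (ω d : ℝ) : Finset ℝ :=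
  (Finset.range k).biUnion fun i => marginLevels c m ω d i ∪ marginLevels c m ω (2 * d) i

theorem card_levels_le (c : ℝ) (m k : ℕ) (ω d : ℝ) : (levels c m k ω d).card ≤ k * 6 := by
  refine (Finset.card_biUnion_le_card_mul _ _ 6 fun i _ => ?_).trans_eq (by rw [Finset.card_range])
  exact (Finset.card_union_le _ _).trans (add_le_add Finset.card_le_three Finset.card_le_three)

theorem marginLevels_subset_levels {c : ℝ} {m k : ℕ} {ω d : ℝ} {i : ℕ} (hi : i < k) :
    marginLevels c m ω d i ⊆ levels c m k ω d ∧ marginLevels c m ω (2 * d) i ⊆ levels c m k ω d :=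
  Finset.union_subset_iff.1 <| Finset.subset_biUnion_of_mem
    (fun i => marginLevels c m ω d i ∪ marginLevels c m ω (2 * d) i) (Finset.mem_range.2 hi)

theorem farm_union_road_subset_margin_zero {c : ℝ} {n m : ℕ} {ω : ℝ} (i : ℕ) :
    farm c m i ∪ road c n m ω i ⊆ margin c n m ω 0 i := by
  rintro p (⟨hp0, hp1⟩ | ⟨hp0, hp1⟩)
  · exact .inl ⟨by simpa using hp0.2, by simpa using hp1⟩
  · exact .inr ⟨hp0.2, by simpa using hp1⟩

theorem Layout.exists_dist_le_of_mem_margin {c : ℝ} {n m k : ℕ} {ω ε : ℝ}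
    (hL : Layout c n m k ω ε) {t : ℝ} (ht : 0 ≤ t) {i : ℕ} {p : Plane} (hp0 : 0 ≤ p 0)
    (hp : p ∈ margin c n m ω t i) : ∃ q ∈ farm c m i ∪ road c n m ω i, dist p q ≤ 2 * t := by
  obtain ⟨-, -, hs, -, hω, hε, hωs, -⟩ := hL
  suffices ∃ x y, pt x y ∈ farm c m i ∪ road c n m ω i ∧ |p 0 - x| ≤ t ∧ |p 1 - y| ≤ t by
    obtain ⟨x, y, hmem, hx, hy⟩ := this
    exact ⟨_, hmem, (dist_le_abs_add_abs _ _).trans (by simp only [pt_zero, pt_one]; linarith)⟩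
  rcases hp with ⟨hpx, hpy⟩ | ⟨hpx, hpy⟩
  · obtain ⟨x, hx, hxp⟩ := exists_mem_Icc_abs_sub_le hs.le ht ⟨by linarith, hpx⟩
    obtain ⟨y, hy, hyp⟩ := exists_mem_Icc_abs_sub_le (by linarith) ht hpy
    exact ⟨x, y, .inl ⟨hx, hy⟩, hxp, hyp⟩
  · obtain ⟨y, hy, hyp⟩ := exists_mem_Icc_abs_sub_le (by linarith) ht hpy
    refine ⟨p 0, y, ?_, by simpa using ht, hyp⟩
    rcases le_total (p 0) (farmSide c m) with hfarm | hroad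
    · exact .inl ⟨⟨hp0, hfarm⟩, hy.1, hy.2.trans (by linarith)⟩
    · exact .inr ⟨⟨hroad, hpx⟩, hy⟩

theorem gridCell_subset_margin {D : Subdivision} {x : ℕ → ℝ} (hx : StrictMono x) {c : ℝ}
    {n m : ℕ} {ω t t' : ℝ} (htt' : t < t') {i : ℕ} (hcol : farmSide c m + t' ∈ Set.range x)
    (hlev : ∀ l ∈ marginLevels c m ω t' i, l ∈ Set.range D.y) {a b : ℕ}
    (ha : x (a + 1) ≤ ridgesWest c n) {p : Plane} (hp : p ∈ D.gridCell x a b)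
    (hpt : p ∈ margin c n m ω t i) : D.gridCell x a b ⊆ margin c n m ω t' i := by
  have hrows : ∀ {l u l' u' : ℝ}, l' ∈ marginLevels c m ω t' i → u' ∈ marginLevels c m ω t' i →
      l' < l → u < u' → p 1 ∈ Set.Icc l u →
      Set.Icc (D.y b) (D.y (b + 1)) ⊆ Set.Icc l' u' := fun hl' hu' hl hu hpu =>
    Set.Icc_subset_Icc
      (le_of_mem_range_lt_succ D.strictMono (hlev _ hl') (by linarith [hp.2.2, hpu.1]))
      (succ_le_of_lt_mem_range D.strictMono (hlev _ hu') (by linarith [hp.2.1, hpu.2]))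
  rcases hpt with ⟨hpx, hpy⟩ | ⟨-, hpy⟩ <;> rintro v ⟨hvx, hvy⟩
  · have hpx' : p 0 ≤ farmSide c m + t := hpx
    refine .inl ⟨hvx.2.trans (succ_le_of_lt_mem_range hx hcol (by linarith [hp.1.1])), ?_⟩
    exact hrows (by simp [marginLevels]) (by simp [marginLevels]) (by linarith) (by linarith)
      hpy hvy
  · refine .inr ⟨hvx.2.trans ha, ?_⟩
    exact hrows (by simp [marginLevels]) (by simp [marginLevels]) (by linarith) (by linarith)
      hpy hvy

open scoped Classical in
/-- The prescribed heights of the vertices of a farming terrain with boundary regions of width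
`5 * d`. West of the ridges everything within `d` of the farms and roads is raised, so that the
triangles which meet a farm or a road have all their vertices at height `h`. -/
def vertexHeight (c : ℝ) (n m k : ℕ) (ω d h : ℝ) (v : Plane) : ℝ :=
  if v 0 < ridgesWest c n then
    if ∃ i < k, v ∈ margin c n m ω d i then h else 0
  else if ∃ j, Odd j ∧ v 0 = ridgeLine c n j then h + ridgesWidth c n / (2 * n) else h

section VertexHeight

variable {c : ℝ} (hc : 0 < c) {n : ℕ} (hn : 1 ≤ n) {m k : ℕ} {ω d h : ℝ} {v : Plane}

include hc hn

theorem vertexHeight_of_even {j : ℕ} (hj : Even j) (hv : v 0 = ridgeLine c n j) :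
    vertexHeight c n m k ω d h v = h := by
  have heast : ¬v 0 < ridgesWest c n := not_lt.2 (hv ▸ ridgesWest_le_ridgeLine hc hn j)
  have hvalley : ¬∃ j, Odd j ∧ v 0 = ridgeLine c n j := by
    rintro ⟨l, hl, hvl⟩
    obtain rfl := (ridgeLine_strictMono hc hn).injective (hv.symm.trans hvl)
    exact Nat.not_odd_iff_even.2 hj hl
  rw [vertexHeight, if_neg heast, if_neg hvalley]

theorem vertexHeight_of_odd {j : ℕ} (hj : Odd j) (hv : v 0 = ridgeLine c n j) :
    vertexHeight c n m k ω d h v = h + ridgesWidth c n / (2 * n) := by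
  have heast : ¬v 0 < ridgesWest c n := not_lt.2 (hv ▸ ridgesWest_le_ridgeLine hc hn j)
  rw [vertexHeight, if_neg heast, if_pos ⟨j, hj, hv⟩]

theorem vertexHeight_of_eq_ridgesWest (hv : v 0 = ridgesWest c n) :
    vertexHeight c n m k ω d h v = h :=
  vertexHeight_of_even hc hn Even.zero (hv.trans (ridgeLine_zero c n).symm)

theorem vertexHeight_of_mem_margin {i : ℕ} (hi : i < k) (hv : v ∈ margin c n m ω d i)
    (hvw : v 0 ≤ ridgesWest c n) : vertexHeight c n m k ω d h v = h := by
  rcases hvw.eq_or_lt with heq | hlt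
  · exact vertexHeight_of_eq_ridgesWest hc hn heq
  · rw [vertexHeight, if_pos hlt, if_pos ⟨i, hi, hv⟩]

theorem vertexHeight_mem_Icc (hh : 0 ≤ h) (hvw : v 0 ≤ ridgesWest c n) :
    vertexHeight c n m k ω d h v ∈ Set.Icc 0 h := by
  rcases hvw.eq_or_lt with heq | hlt
  · rw [vertexHeight_of_eq_ridgesWest hc hn heq]
    exact ⟨hh, le_rfl⟩
  · rw [vertexHeight, if_pos hlt]
    split_ifs
    exacts [⟨hh, le_rfl⟩, ⟨le_rfl, hh⟩]

end VertexHeight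

theorem vertexHeight_of_notMem_margin {c : ℝ} {n m k : ℕ} {ω d h : ℝ} {v : Plane}
    (hvw : v 0 < ridgesWest c n) (hv : ∀ i < k, v ∉ margin c n m ω d i) :
    vertexHeight c n m k ω d h v = 0 := by
  rw [vertexHeight, if_pos hvw, if_neg (by push Not; exact hv)]

namespace Layout

variable {c : ℝ} {n m k : ℕ} {ω d h : ℝ} (hL : Layout c n m k ω (5 * d))

include hL

theorem columnX_strictMono : StrictMono (columnX c n m d) := by
  obtain ⟨hc, hn, hs, -, -, hε, -, hgap⟩ := hL
  refine strictMono_nat_of_lt_succ fun a => ?_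
  match a with
  | 0 => simp only [columnX]; linarith
  | 1 => simp only [columnX]; linarith
  | 2 => simp only [columnX]; linarith
  | 3 => simp only [columnX, ridgeLine_zero]; linarith
  | j + 4 => exact ridgeLine_strictMono hc hn (Nat.lt_succ_self j)

theorem levels_subset_Icc : ∀ l ∈ levels c m k ω d, l ∈ Set.Icc (0 : ℝ) 1 := by
  intro l hl
  simp only [levels, marginLevels, Finset.mem_biUnion, Finset.mem_range, Finset.mem_union,
    Finset.mem_insert, Finset.mem_singleton] at hl
  obtain ⟨i, hi, hl⟩ := hl
  have hS := farmSide_le_farmSouth hL.side_pos hL.fit hi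
  have hS' := farmSouth_add_le_one hL.side_pos i
  have hω := hL.ω_nonneg
  have hωs := hL.ω_lt
  have hε := hL.ε_pos
  rcases hl with (rfl | rfl | rfl) | (rfl | rfl | rfl) <;> constructor <;> linarith

/-- The triangulation of a farming terrain. -/
def farmingStrips (D : Subdivision) : StripSystem :=
  D.gridFan 4 (2 * n) (columnX c n m d) hL.columnX_strictMono rfl (ridgeLine_last c hL.one_le_n)

variable {D : Subdivision} {T : Terrain}
  (hT : (hL.farmingStrips D).Interpolates T (vertexHeight c n m k ω d h))

include hT

theorem height_of_even_ridge {j : ℕ} (hj : j < 2 * n) (he : Even j) {p : Plane}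
    (hp : p ∈ unitSquare) (hpj : p 0 ∈ Set.Icc (ridgeLine c n j) (ridgeLine c n (j + 1))) :
    T.height p = h + (p 0 - ridgeLine c n j) := by
  rw [hT.height_eq_of_strip (a := j + 4) (Nat.add_lt_add_right hj 4)
    (affineFn 1 0 (h - ridgeLine c n j)) ?_ hp hpj, affineFn_apply]
  · ring
  rintro v (hv | hv)
  · rw [vertexHeight_of_even hL.c_pos hL.one_le_n he hv, affineFn_apply,
      show v 0 = ridgeLine c n j from hv]
    ring
  · rw [vertexHeight_of_odd hL.c_pos hL.one_le_n he.add_one hv, affineFn_apply,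
      show v 0 = ridgeLine c n (j + 1) from hv, ridgeLine_succ]
    ring

theorem height_of_odd_ridge {j : ℕ} (hj : j < 2 * n) (ho : Odd j) {p : Plane}
    (hp : p ∈ unitSquare) (hpj : p 0 ∈ Set.Icc (ridgeLine c n j) (ridgeLine c n (j + 1))) :
    T.height p = h + (ridgeLine c n (j + 1) - p 0) := by
  rw [hT.height_eq_of_strip (a := j + 4) (Nat.add_lt_add_right hj 4)
    (affineFn (-1) 0 (h + ridgeLine c n (j + 1))) ?_ hp hpj, affineFn_apply]
  · ring
  rintro v (hv | hv)
  · rw [vertexHeight_of_odd hL.c_pos hL.one_le_n ho hv, affineFn_apply,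
      show v 0 = ridgeLine c n j from hv, ridgeLine_succ]
    ring
  · rw [vertexHeight_of_even hL.c_pos hL.one_le_n ho.add_one hv, affineFn_apply,
      show v 0 = ridgeLine c n (j + 1) from hv]
    ring

omit hT in
theorem columnX_succ_le {a : ℕ} (ha : a < 4) : columnX c n m d (a + 1) ≤ ridgesWest c n :=
  columnX_four c n m d ▸ hL.columnX_strictMono.monotone ha

omit hL hT in
theorem exists_mem_gridCell {p : Plane} (hp : p ∈ unitSquare) (hpw : p 0 ≤ ridgesWest c n) :
    ∃ a < 4, ∃ b < D.N, p ∈ D.gridCell (columnX c n m d) a b :=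
  D.exists_mem_gridCell _ rfl four_pos hp (hpw.trans_eq (columnX_four c n m d).symm)

theorem height_mem_Icc (hh : 0 ≤ h) {p : Plane} (hp : p ∈ unitSquare)
    (hpw : p 0 ≤ ridgesWest c n) : T.height p ∈ Set.Icc 0 h := by
  obtain ⟨a, ha, b, hb, hpab⟩ := exists_mem_gridCell (D := D) hp hpw
  exact D.height_mem_of_mem_gridCell hT ha hb (convex_Icc 0 h) (fun v hv =>
    vertexHeight_mem_Icc hL.c_pos hL.one_le_n hh (hv.1.2.trans (hL.columnX_succ_le ha))) hpab

variable (hD : ∀ l ∈ levels c m k ω d, l ∈ Set.range D.y)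

include hD

theorem height_of_mem_farm_union_road {i : ℕ} (hi : i < k) {p : Plane}
    (hp : p ∈ farm c m i ∪ road c n m ω i) : T.height p = h := by
  have hd : 0 < d := by linarith [hL.ε_pos]
  have hpw : p 0 ≤ ridgesWest c n := hp.elim
    (fun hp => by linarith [hp.1.2, hL.gap]) (fun hp => hp.1.2)
  obtain ⟨a, ha, b, hb, hpab⟩ := exists_mem_gridCell (D := D)
    (hL.farm_union_road_subset_unitSquare hi hp) hpw
  have hsub : D.gridCell (columnX c n m d) a b ⊆ margin c n m ω d i :=
    gridCell_subset_margin hL.columnX_strictMono hd ⟨1, rfl⟩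
      (fun l hl => hD l ((marginLevels_subset_levels hi).1 hl)) (hL.columnX_succ_le ha) hpab
      (farm_union_road_subset_margin_zero i hp)
  exact D.height_mem_of_mem_gridCell hT ha hb (convex_singleton h) (fun v hv =>
    vertexHeight_of_mem_margin hL.c_pos hL.one_le_n hi (hsub hv)
      (hv.1.2.trans (hL.columnX_succ_le ha))) hpab

theorem height_eq_zero_of_forall_le_dist {p : Plane} (hp : p ∈ unitSquare)
    (hfar : ∀ q ∈ builtArea c n m k ω, 5 * d ≤ dist p q) : T.height p = 0 := by
  have hd : 0 < d := by linarith [hL.ε_pos]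
  have hX := hL.columnX_strictMono
  have hpw : p 0 < ridgesWest c n := not_le.1 fun hpw => by
    linarith [hfar p (.inr ⟨hp, hpw⟩), dist_self p]
  obtain ⟨a, ha, b, hb, hpab⟩ := exists_mem_gridCell (D := D) hp hpw.le
  refine D.height_mem_of_mem_gridCell hT ha hb (convex_singleton 0) (fun v hv => ?_) hpab
  rcases (hv.1.2.trans (hL.columnX_succ_le ha)).eq_or_lt with hvw | hvw
  · have ha3 : 3 ≤ a := Nat.le_of_lt_succ <| Nat.lt_of_succ_le <| hX.le_iff_le.1 <|
      (columnX_four c n m d).le.trans (hvw.ge.trans hv.1.2)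
    have hp3 : ridgesWest c n - d ≤ p 0 := (hX.monotone ha3).trans hpab.1.1
    have hq : pt (ridgesWest c n) (p 1) ∈ unitSquare :=
      pt_mem_unitSquare ⟨(hp 0).1.trans hpw.le, (ridgesWest_lt_one hL.c_pos n).le⟩ (hp 1)
    have hdist := dist_le_abs_add_abs p (pt (ridgesWest c n) (p 1))
    rw [pt_zero, pt_one, sub_self, abs_zero, abs_of_neg (sub_neg.2 hpw)] at hdist
    linarith [hfar _ (.inr ⟨hq, le_rfl⟩)]
  · refine vertexHeight_of_notMem_margin hvw fun i hi hvi => ?_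
    have hpi : p ∈ margin c n m ω (2 * d) i :=
      gridCell_subset_margin hX (by linarith) ⟨2, rfl⟩
        (fun l hl => hD l ((marginLevels_subset_levels hi).2 hl)) (hL.columnX_succ_le ha) hv hvi
        hpab
    obtain ⟨q, hq, hpq⟩ := hL.exists_dist_le_of_mem_margin (by linarith) (hp 0).1 hpi
    linarith [hfar q (farm_union_road_subset_builtArea hi hq)]

theorem isFarmingTerrain (hh : 0 ≤ h) : IsFarmingTerrain T c n m k ω (5 * d) h where
  height_farm_road _ hi _ hp := hL.height_of_mem_farm_union_road hT hD hi hp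
  height_ridge_up _ hj he _ hp hpj := hL.height_of_even_ridge hT hj he hp hpj
  height_ridge_down _ hj ho _ hp hpj := hL.height_of_odd_ridge hT hj ho hp hpj
  height_forbidden _ hp hfar := hL.height_eq_zero_of_forall_le_dist hT hD hp hfar
  height_boundary _ hp hpb := hL.height_mem_Icc hT hh hp
    (not_le.1 fun hpw => hpb (.inr ⟨hp, hpw⟩)).le

end Layout

theorem Layout.exists_isFarmingTerrain {c : ℝ} {n m k : ℕ} {ω ε h : ℝ}
    (hL : Layout c n m k ω ε) (hh : 0 ≤ h) :
    ∃ T : Terrain, IsFarmingTerrain T c n m k ω ε h ∧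
      T.triangulation.vertices.ncard ≤ 5 * (6 * k + 2) + 4 * n := by
  obtain ⟨d, rfl⟩ : ∃ d, ε = 5 * d := ⟨ε / 5, by ring⟩
  obtain ⟨D, hN, hD⟩ := exists_subdivision _ hL.levels_subset_Icc
  obtain ⟨T, hT⟩ := (hL.farmingStrips D).exists_interpolates (vertexHeight c n m k ω d h)
  refine ⟨T, hL.isFarmingTerrain hT hD hh, ?_⟩
  have hcard := card_levels_le c m k ω d
  calc T.triangulation.vertices.ncard
      ≤ (4 + 1) * (D.N + 1) + 2 * (2 * n) := hT.1 ▸ D.ncard_vertices_gridFan_le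
    _ ≤ 5 * (6 * k + 2) + 4 * n := by lia

theorem eVariationOn_comp_trans_le {X E : Type*} [TopologicalSpace X] [PseudoEMetricSpace E]
    (f : X → E) {x y z : X} (γ : Path x y) (γ' : Path y z) :
    eVariationOn (f ∘ γ.trans γ') Set.univ
      ≤ eVariationOn (f ∘ γ) Set.univ + eVariationOn (f ∘ γ') Set.univ := by
  let half : unitInterval := ⟨1 / 2, by norm_num, by norm_num⟩
  have hmono (a : ℝ) : Monotone fun t : unitInterval =>
      Set.projIcc (0 : ℝ) 1 zero_le_one (2 * t - a) := fun s t hst =>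
    Set.monotone_projIcc _ (by linarith [Subtype.coe_le_coe.2 hst])
  have hleft : Set.EqOn (f ∘ γ.trans γ')
      ((f ∘ γ) ∘ fun t => Set.projIcc 0 1 zero_le_one (2 * (t : ℝ) - 0)) (Set.Iic half) := by
    intro t ht
    simp only [Function.comp_apply, sub_zero]
    rw [← (γ.trans γ').extend_apply t.2, γ.extend_trans_of_le_half γ' (by exact ht)]
    rfl
  have hright : Set.EqOn (f ∘ γ.trans γ')
      ((f ∘ γ') ∘ fun t => Set.projIcc 0 1 zero_le_one (2 * (t : ℝ) - 1)) (Set.Ici half) := by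
    intro t ht
    simp only [Function.comp_apply]
    rw [← (γ.trans γ').extend_apply t.2, γ.extend_trans_of_half_le γ' (by exact ht)]
    rfl
  rw [← Set.Iic_union_Ici (a := half), eVariationOn.union _ isGreatest_Iic isLeast_Ici,
    Set.Iic_union_Ici, eVariationOn.congr hleft, eVariationOn.congr hright]
  exact add_le_add
    (eVariationOn.comp_le_of_monotoneOn _ _ ((hmono 0).monotoneOn _) (Set.mapsTo_univ _ _))
    (eVariationOn.comp_le_of_monotoneOn _ _ ((hmono 1).monotoneOn _) (Set.mapsTo_univ _ _))

theorem eVariationOn_coe_unitInterval :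
    eVariationOn ((↑) : unitInterval → ℝ) Set.univ = 1 := by
  have hmono : MonotoneOn ((↑) : unitInterval → ℝ) Set.univ := fun _ _ _ _ h => h
  have h := hmono.eVariationOn_eq (Set.mem_univ ⊥) (Set.mem_univ ⊤)
  rw [Set.univ_inter, Set.Icc_bot_top] at h
  simpa using h

theorem eVariationOn_lineMap_le {E : Type*} [SeminormedAddCommGroup E] [NormedSpace ℝ E]
    (a b : E) :
    eVariationOn (fun t : unitInterval => AffineMap.lineMap (k := ℝ) a b (t : ℝ)) Set.univ
      ≤ edist a b := by
  have h := ((lipschitzWith_lineMap (𝕜 := ℝ) a b).lipschitzOnWith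
    (s := Set.univ)).comp_eVariationOn_le (Set.mapsTo_univ ((↑) : unitInterval → ℝ) Set.univ)
  rwa [eVariationOn_coe_unitInterval, mul_one, ← edist_nndist] at h

theorem mem_interior_convexHull_of_notMem_facets {ι E : Type*} [Finite ι] [NormedAddCommGroup E]
    [NormedSpace ℝ E] (b : AffineBasis ι ℝ E) {x : E} (hx : x ∈ convexHull ℝ (Set.range b))
    (hfacet : ∀ i, x ∉ convexHull ℝ (b '' {i}ᶜ)) : x ∈ interior (convexHull ℝ (Set.range b)) := by
  classical
  cases nonempty_fintype ι
  rw [b.convexHull_eq_nonneg_coord] at hx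
  rw [b.interior_convexHull]
  refine fun i => (hx i).lt_of_ne' fun hi => hfacet i ?_
  have hsum := b.linear_combination_coord_eq_self x
  have hone := b.sum_coord_apply_eq_one x
  rw [← Finset.add_sum_erase _ _ (Finset.mem_univ i), hi] at hsum hone
  rw [zero_smul, zero_add] at hsum
  rw [zero_add] at hone
  rw [← hsum]
  exact (convex_convexHull ℝ _).sum_mem (fun j _ => hx j) hone fun j hj =>
    subset_convexHull ℝ _ ⟨j, (Finset.mem_erase.1 hj).1, rfl⟩

namespace Terrain

variable (T : Terrain)

@[simp] theorem lift_zero (p : Plane) : T.lift p 0 = p 0 := rfl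

@[simp] theorem lift_one (p : Plane) : T.lift p 1 = p 1 := rfl

@[simp] theorem lift_two (p : Plane) : T.lift p 2 = T.height p := rfl

theorem ofReal_abs_sub_le_edist_lift (p q : Plane) (i : Fin 3) :
    ENNReal.ofReal |T.lift p i - T.lift q i| ≤ edist (T.lift p) (T.lift q) := by
  rw [edist_dist, dist_eq_norm]
  exact ENNReal.ofReal_le_ofReal (PiLp.norm_apply_le (T.lift p - T.lift q) i)

theorem edist_lift_le (p q : Plane) : edist (T.lift p) (T.lift q) ≤
    ENNReal.ofReal (|p 0 - q 0| + |p 1 - q 1| + |T.height p - T.height q|) := by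
  rw [edist_dist, EuclideanSpace.dist_eq, Fin.sum_univ_three]
  simp only [lift_zero, lift_one, lift_two, Real.dist_eq]
  refine ENNReal.ofReal_le_ofReal (Real.sqrt_le_iff.2 ⟨by positivity, ?_⟩)
  have h0 := abs_nonneg (p 0 - q 0)
  have h1 := abs_nonneg (p 1 - q 1)
  have h2 := abs_nonneg (T.height p - T.height q)
  nlinarith [mul_nonneg h0 h1, mul_nonneg h0 h2, mul_nonneg h1 h2]

theorem edist_lift_le_pathLength {p q : unitSquare} (γ : Path p q) (t u : unitInterval) :
    edist (T.lift (γ t)) (T.lift (γ u)) ≤ T.pathLength γ :=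
  eVariationOn.edist_le (fun t => T.lift (γ t)) (Set.mem_univ t) (Set.mem_univ u)

theorem edist_lift_add_le_pathLength {p q : unitSquare} (γ : Path p q) (t : unitInterval) :
    edist (T.lift p) (T.lift (γ t)) + edist (T.lift (γ t)) (T.lift q) ≤ T.pathLength γ := by
  let f := fun t => T.lift (γ t)
  calc edist (T.lift p) (T.lift (γ t)) + edist (T.lift (γ t)) (T.lift q)
      = edist (f 0) (f t) + edist (f t) (f 1) := by simp only [f, γ.source, γ.target]
    _ ≤ eVariationOn f (Set.Iic t) + eVariationOn f (Set.Ici t) :=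
        add_le_add (eVariationOn.edist_le f unitInterval.nonneg' Set.self_mem_Iic)
          (eVariationOn.edist_le f Set.self_mem_Ici unitInterval.le_one')
    _ = T.pathLength γ := by
        rw [← eVariationOn.union f isGreatest_Iic isLeast_Ici, Set.Iic_union_Ici, pathLength]

theorem geoDist_triangle (p q r : unitSquare) :
    T.geoDist p r ≤ T.geoDist p q + T.geoDist q r :=
  ENNReal.le_iInf_add_iInf fun γ γ' =>
    (iInf_le _ (γ.trans γ')).trans
      (eVariationOn_comp_trans_le (fun z : unitSquare => T.lift z) γ γ')

theorem lift_lineMap {p q : Plane} {A : Plane →ᵃ[ℝ] ℝ}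
    (hA : Set.EqOn T.height A (segment ℝ p q)) {t : ℝ} (ht : t ∈ Set.Icc (0 : ℝ) 1) :
    T.lift (AffineMap.lineMap p q t) = AffineMap.lineMap (T.lift p) (T.lift q) t := by
  have hheight : T.height (AffineMap.lineMap p q t)
      = AffineMap.lineMap (T.height p) (T.height q) t := by
    rw [hA (lineMap_mem_segment ℝ p q ht), hA (left_mem_segment ℝ p q),
      hA (right_mem_segment ℝ p q), AffineMap.apply_lineMap]
  ext i
  fin_cases i
  · simp [AffineMap.lineMap_apply_module]
  · simp [AffineMap.lineMap_apply_module]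
  · simpa [AffineMap.lineMap_apply_module] using hheight

theorem geoDist_le_edist_lift {p q : unitSquare} {A : Plane →ᵃ[ℝ] ℝ}
    (hA : Set.EqOn T.height A (segment ℝ (p : Plane) q)) :
    T.geoDist p q ≤ edist (T.lift p) (T.lift q) := by
  let γ : Path p q :=
    { toFun := fun t => ⟨Path.segment (p : Plane) q t,
        convex_unitSquare.segment_subset p.2 q.2 (lineMap_mem_segment ℝ (p : Plane) q t.2)⟩
      continuous_toFun := (Path.segment (p : Plane) q).continuous.subtype_mk _
      source' := Subtype.ext (Path.segment (p : Plane) q).source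
      target' := Subtype.ext (Path.segment (p : Plane) q).target }
  calc T.geoDist p q ≤ T.pathLength γ := iInf_le _ γ
    _ = eVariationOn (fun t : unitInterval => AffineMap.lineMap (T.lift p) (T.lift q) (t : ℝ))
          Set.univ := eVariationOn.congr fun t _ => T.lift_lineMap hA t.2
    _ ≤ edist (T.lift p) (T.lift q) := eVariationOn_lineMap_le _ _

theorem exists_mem_interior_of_notMem_skeleton {z : unitSquare} (hz : z ∉ T.skeleton) :
    ∃ s ∈ T.triangulation.faces, (z : Plane) ∈ interior (convexHull ℝ (s : Set Plane)) := by
  classical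
  obtain ⟨s, hs, hzs⟩ := Geometry.SimplicialComplex.mem_space_iff.1 (T.space_eq.ge z.2)
  have hind := T.triangulation.indep hs
  have hcard : s.card = 3 := by
    refine le_antisymm ?_ (not_lt.1 fun h => hz ⟨s, hs, Nat.le_of_lt_succ h, hzs⟩)
    rw [← Fintype.card_coe]
    exact hind.card_le_finrank_succ.trans
      (Nat.succ_le_succ ((Submodule.finrank_le _).trans_eq finrank_euclideanSpace_fin))
  have hspan : affineSpan ℝ (Set.range ((↑) : s → Plane)) = ⊤ :=
    hind.affineSpan_eq_top_iff_card_eq_finrank_add_one.2 (by simp [hcard])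
  let b : AffineBasis s ℝ Plane := ⟨(↑), hind, hspan⟩
  have hrange : Set.range b = (s : Set Plane) := Subtype.range_coe
  refine ⟨s, hs, hrange ▸ mem_interior_convexHull_of_notMem_facets b (hrange.symm ▸ hzs) ?_⟩
  intro i hi
  have herase : b '' {i}ᶜ = ((s.erase i : Finset Plane) : Set Plane) := by
    rw [Set.image_compl_eq_range_sdiff_image b.ind.injective, hrange, Set.image_singleton,
      Finset.coe_erase]
    rfl
  rw [herase] at hi
  have hne : (s.erase i).Nonempty := Finset.coe_nonempty.1 (convexHull_nonempty_iff.1 ⟨_, hi⟩)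
  exact hz ⟨s.erase i, T.triangulation.down_closed hs (Finset.erase_subset _ _) hne,
    by rw [Finset.card_erase_of_mem i.2, hcard], hi⟩

theorem exists_affine_of_notMem_skeleton {z : unitSquare} (hz : z ∉ T.skeleton) :
    ∃ A : Plane →ᵃ[ℝ] ℝ, T.height =ᶠ[nhds (z : Plane)] A := by
  obtain ⟨s, hs, hzs⟩ := T.exists_mem_interior_of_notMem_skeleton hz
  obtain ⟨A, hA⟩ := T.affine_on_faces s hs
  exact ⟨A, Filter.eventuallyEq_of_mem (mem_interior_iff_mem_nhds.1 hzs) hA⟩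

theorem encard_le_voronoiComplexity {m : ℕ} (P : Fin m → unitSquare) :
    {z | z ∈ T.skeleton ∧ 2 ≤ (T.incident P z).encard}.encard ≤ T.voronoiComplexity P := by
  have hsub : {z | z ∈ T.skeleton ∧ 2 ≤ (T.incident P z).encard} ⊆
      (T.voronoiVertices P ∪ T.breakpoints P) ∪ (T.chordPoints P ∩ T.skeleton) := by
    rintro z ⟨hz, htwo⟩
    rcases htwo.eq_or_lt with hedge | hvertex
    · by_cases hb : z ∈ T.breakpoints P
      · exact .inl (.inr hb)
      · exact .inr ⟨⟨hedge.symm, hb⟩, hz⟩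
    · exact .inl (.inl (Order.add_one_le_of_lt hvertex))
  exact (Set.encard_le_encard hsub).trans ((Set.encard_union_le _ _).trans
    (add_le_add (Set.encard_union_le _ _) le_rfl))

end Terrain

theorem exists_last_eq {f : unitInterval → ℝ} (hf : Continuous f) {a : ℝ} (h0 : a ≤ f 0)
    (h1 : f 1 ≤ a) : ∃ σ, f σ = a ∧ ∀ t ≥ σ, f t ≤ a := by
  obtain ⟨σ, hσ, hmax⟩ : ∃ σ, IsGreatest {t | a ≤ f t} σ :=
    (isClosed_le continuous_const hf).isCompact.exists_isGreatest ⟨0, h0⟩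
  obtain ⟨τ, ⟨hστ, -⟩, hτ⟩ :=
    intermediate_value_Icc' (unitInterval.le_one' : σ ≤ 1) hf.continuousOn ⟨h1, hσ⟩
  obtain rfl : σ = τ := hστ.antisymm (hmax hτ.ge)
  refine ⟨σ, hτ, fun t ht => ?_⟩
  rcases ht.eq_or_lt with rfl | hlt
  · exact hτ.le
  · exact (not_le.1 fun hat => hlt.not_ge (hmax hat)).le

theorem mem_Ioo_of_isPreconnected {X : Type*} [TopologicalSpace X] {s : Set X}
    (hs : IsPreconnected s) {f : X → ℝ} (hf : ContinuousOn f s) {l u : ℝ}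
    (hl : ∀ x ∈ s, f x ≠ l) (hu : ∀ x ∈ s, f x ≠ u) {x y : X} (hx : x ∈ s) (hy : y ∈ s)
    (hfx : f x ∈ Set.Ioo l u) : f y ∈ Set.Ioo l u := by
  refine ⟨not_le.1 fun hyl => ?_, not_le.1 fun huy => ?_⟩
  · obtain ⟨t, ht, htl⟩ := hs.intermediate_value hy hx hf ⟨hyl, hfx.1.le⟩
    exact hl t ht htl
  · obtain ⟨t, ht, htu⟩ := hs.intermediate_value hx hy hf ⟨hfx.2.le, huy⟩
    exact hu t ht htu

theorem continuous_path_coord {p q : unitSquare} (γ : Path p q) (i : Fin 2) :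
    Continuous fun t => (γ t : Plane) i :=
  (EuclideanSpace.proj (𝕜 := ℝ) i).continuous.comp (continuous_subtype_val.comp γ.continuous)

theorem farmSouth_strictAnti {c : ℝ} {m : ℕ} (hs : 0 < farmSide c m) :
    StrictAnti (farmSouth c m) := by
  intro i l h
  have hil : (i : ℝ) < l := Nat.cast_lt.2 h
  simp only [farmSouth]
  nlinarith

theorem three_mul_farmSide_le_abs_sub {c : ℝ} {m i l : ℕ} (hs : 0 ≤ farmSide c m) (hil : i ≠ l) :
    3 * farmSide c m ≤ |farmSouth c m i - farmSouth c m l| := by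
  have hgap : (1 : ℝ) ≤ |(l : ℝ) - i| := by
    exact_mod_cast Int.one_le_abs (sub_ne_zero.2 (Nat.cast_injective.ne hil.symm : (l : ℤ) ≠ i))
  rw [show farmSouth c m i - farmSouth c m l = 3 * farmSide c m * ((l : ℝ) - i) by
    simp only [farmSouth]; ring, abs_mul, abs_of_nonneg (by positivity)]
  exact le_mul_of_one_le_right (by positivity) hgap

theorem eq_of_abs_farmSouth_sub_lt {c : ℝ} {m i l : ℕ} (hs : 0 ≤ farmSide c m)
    (h : |farmSouth c m i - farmSouth c m l| < 3 * farmSide c m) : i = l :=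
  of_not_not fun hil => h.not_ge (three_mul_farmSide_le_abs_sub hs hil)

theorem ne_between_farms {c : ℝ} {m b l : ℕ} {ε y : ℝ} (hs : 0 < farmSide c m)
    (hε : ε < farmSide c m)
    (hy : y ∈ Set.Ioo (farmSouth c m b - ε) (farmSouth c m b + farmSide c m + ε)) :
    y ≠ farmSouth c m l - farmSide c m ∧ y ≠ farmSouth c m l + 2 * farmSide c m := by
  constructor <;> rintro rfl <;>
  · obtain rfl : b = l := eq_of_abs_farmSouth_sub_lt hs.le
      (abs_lt.2 ⟨by linarith [hy.2], by linarith [hy.1]⟩)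
    linarith [hy.1, hy.2]

theorem farm_eq_rect (c : ℝ) (m i : ℕ) : farm c m i = rect (Set.Icc 0 (farmSide c m))
    (Set.Icc (farmSouth c m i) (farmSouth c m i + farmSide c m)) :=
  rfl

theorem road_eq_rect (c : ℝ) (n m : ℕ) (ω : ℝ) (i : ℕ) :
    road c n m ω i = rect (Set.Icc (farmSide c m) (ridgesWest c n))
      (Set.Icc (farmSouth c m i) (farmSouth c m i + ω)) :=
  rfl

namespace Layout

variable {c : ℝ} {n m k : ℕ} {ω ε : ℝ}

theorem farmSouth_mem_Icc (hL : Layout c n m k ω ε) {i : ℕ} (hi : i < k) :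
    farmSouth c m i ∈ Set.Icc (0 : ℝ) 1 := by
  have hs := hL.side_pos
  have hlow := farmSide_le_farmSouth hs hL.fit hi
  have hup := farmSouth_add_le_one hs i
  constructor <;> linarith

theorem ridgesWest_mem_Icc (hL : Layout c n m k ω ε) : ridgesWest c n ∈ Set.Icc (0 : ℝ) 1 :=
  ⟨by linarith [hL.gap, hL.side_pos, hL.ε_pos], (ridgesWest_lt_one hL.c_pos n).le⟩

theorem ridgeLine_mem_Icc (hL : Layout c n m k ω ε) {j : ℕ} (hj : j ≤ 2 * n) :
    ridgeLine c n j ∈ Set.Icc (ridgesWest c n) 1 := by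
  have hmono := (ridgeLine_strictMono hL.c_pos hL.one_le_n).monotone
  exact ⟨(ridgeLine_zero c n).symm.trans_le (hmono j.zero_le),
    (hmono hj).trans_eq (ridgeLine_last c hL.one_le_n)⟩

theorem pt_ridgeLine_mem_unitSquare (hL : Layout c n m k ω ε) {j : ℕ} (hj : j ≤ 2 * n) {y : ℝ}
    (hy : y ∈ Set.Icc (0 : ℝ) 1) : pt (ridgeLine c n j) y ∈ unitSquare :=
  pt_mem_unitSquare (Set.Icc_subset_Icc_left hL.ridgesWest_mem_Icc.1 (hL.ridgeLine_mem_Icc hj)) hy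

end Layout

theorem Terrain.geoDist_le_of_height_eq (T : Terrain) {C : Set Plane} (hC : Convex ℝ C)
    {a b : ℝ} (hH : ∀ r ∈ C, T.height r = a * r 0 + b) {p q : unitSquare} (hp : (p : Plane) ∈ C)
    (hq : (q : Plane) ∈ C) : T.geoDist p q ≤ ENNReal.ofReal
      ((1 + |a|) * |(p : Plane) 0 - (q : Plane) 0| + |(p : Plane) 1 - (q : Plane) 1|) := by
  have haffine : Set.EqOn T.height (affineFn a 0 b) (segment ℝ (p : Plane) q) := fun r hr => by
    rw [hH r (hC.segment_subset hp hq hr), affineFn_apply]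
    ring
  refine (T.geoDist_le_edist_lift haffine).trans ((T.edist_lift_le p q).trans_eq ?_)
  rw [hH p hp, hH q hq, add_sub_add_right_eq_sub, ← mul_sub, abs_mul]
  ring_nf

theorem Terrain.eventually_height_add_height_sub (T : Terrain) {z : unitSquare}
    (hz : z ∉ T.skeleton) (v : Plane) :
    ∀ᶠ t : ℝ in nhds 0, T.height (z + t • v) + T.height (z - t • v) = 2 * T.height z := by
  obtain ⟨A, hA⟩ := T.exists_affine_of_notMem_skeleton hz
  have hadd : Filter.Tendsto (fun t : ℝ => (z : Plane) + t • v) (nhds 0) (nhds (z : Plane)) :=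
    Continuous.tendsto' (by fun_prop) _ _ (by simp)
  have hsub : Filter.Tendsto (fun t : ℝ => (z : Plane) - t • v) (nhds 0) (nhds (z : Plane)) :=
    Continuous.tendsto' (by fun_prop) _ _ (by simp)
  filter_upwards [hadd.eventually hA, hsub.eventually hA] with t htadd htsub
  have hlin (x : Plane) : A x = A.linear x + A 0 := congrFun A.decomp x
  rw [htadd, htsub, hA.eq_of_nhds, hlin, hlin (z - t • v), hlin z, map_add, map_sub]
  ring

/-- Parameters for which the ridges, the roads and the boundary regions are narrow compared to
the farms, and for which the forbidden area is too deep to be crossed by a shortest path. -/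
structure Admissible (c : ℝ) (n m k : ℕ) (ω ε h : ℝ) : Prop extends Layout c n m k ω ε where
  narrow : 2 * ridgesWidth c n + ω + 3 * ε < farmSide c m
  high : 4 ≤ h

namespace IsFarmingTerrain

variable {T : Terrain} {c : ℝ} {n m k : ℕ} {ω ε h : ℝ}
  (hT : IsFarmingTerrain T c n m k ω ε h)

include hT

theorem exists_height_eq_on_ridge {j : ℕ} (hj : j < 2 * n) : ∃ a b : ℝ, |a| = 1 ∧
    ∀ p ∈ unitSquare ∩ {p | p 0 ∈ Set.Icc (ridgeLine c n j) (ridgeLine c n (j + 1))},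
      T.height p = a * p 0 + b := by
  rcases Nat.even_or_odd j with he | ho
  · refine ⟨1, h - ridgeLine c n j, abs_one, fun p hp => ?_⟩
    rw [hT.height_ridge_up j hj he p hp.1 hp.2]
    ring
  · refine ⟨-1, h + ridgeLine c n (j + 1), by rw [abs_neg, abs_one], fun p hp => ?_⟩
    rw [hT.height_ridge_down j hj ho p hp.1 hp.2]
    ring

theorem le_height_of_mem_ridge {j : ℕ} (hj : j < 2 * n) {p : Plane} (hp : p ∈ unitSquare)
    (hpj : p 0 ∈ Set.Icc (ridgeLine c n j) (ridgeLine c n (j + 1))) : h ≤ T.height p := by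
  rcases Nat.even_or_odd j with he | ho
  · rw [hT.height_ridge_up j hj he p hp hpj]
    linarith [hpj.1]
  · rw [hT.height_ridge_down j hj ho p hp hpj]
    linarith [hpj.2]

theorem geoDist_le_of_mem_ridge {j : ℕ} (hj : j < 2 * n) {z z' : unitSquare}
    (hz : (z : Plane) 0 ∈ Set.Icc (ridgeLine c n j) (ridgeLine c n (j + 1)))
    (hz' : (z' : Plane) 0 ∈ Set.Icc (ridgeLine c n j) (ridgeLine c n (j + 1))) :
    T.geoDist z z' ≤ ENNReal.ofReal
      (2 * |(z : Plane) 0 - (z' : Plane) 0| + |(z : Plane) 1 - (z' : Plane) 1|) := by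
  obtain ⟨a, b, ha, hab⟩ := hT.exists_height_eq_on_ridge hj
  have hconv : Convex ℝ {p : Plane | p 0 ∈ Set.Icc (ridgeLine c n j) (ridgeLine c n (j + 1))} :=
    (convex_Icc _ _).linear_preimage (EuclideanSpace.proj (0 : Fin 2) : Plane →L[ℝ] ℝ).toLinearMap
  have hdist := T.geoDist_le_of_height_eq (convex_unitSquare.inter hconv) hab
    ⟨z.2, hz⟩ ⟨z'.2, hz'⟩
  rwa [ha, one_add_one_eq_two] at hdist

theorem geoDist_le_of_ridgeLine (hL : Layout c n m k ω ε) {j : ℕ} (hj : j ≤ 2 * n)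
    {z z' : unitSquare} (hz : (z : Plane) 0 = ridgeLine c n j)
    (hz' : (z' : Plane) 0 = ridgesWest c n) (hy : (z : Plane) 1 = (z' : Plane) 1) :
    T.geoDist z z' ≤ ENNReal.ofReal (2 * (ridgeLine c n j - ridgesWest c n)) := by
  have hmono := ridgeLine_strictMono hL.c_pos hL.one_le_n
  induction j generalizing z with
  | zero =>
    have hle := (hmono Nat.zero_lt_one).le
    rw [← ridgeLine_zero] at hz'
    have hn := hL.one_le_n
    simpa [hz, hz', hy, ridgeLine_zero] using
      hT.geoDist_le_of_mem_ridge (j := 0) (by omega) ⟨hz.ge, hz.trans_le hle⟩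
        ⟨hz'.ge, hz'.trans_le hle⟩
  | succ j ih =>
    have hlt : ridgeLine c n j < ridgeLine c n (j + 1) := hmono j.lt_succ_self
    have hwest := (hL.ridgeLine_mem_Icc (Nat.le_of_succ_le hj)).1
    let u : unitSquare :=
      ⟨pt (ridgeLine c n j) ((z : Plane) 1),
        hL.pt_ridgeLine_mem_unitSquare (Nat.le_of_succ_le hj) (z.2 1)⟩
    have hu : (u : Plane) 0 = ridgeLine c n j := rfl
    have hstep := hT.geoDist_le_of_mem_ridge (z := z) (z' := u) hj
      ⟨hlt.le.trans hz.ge, hz.le⟩ ⟨le_rfl, hlt.le⟩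
    rw [hz, hu, abs_of_pos (sub_pos.2 hlt), show (u : Plane) 1 = (z : Plane) 1 from rfl, sub_self,
      abs_zero, add_zero] at hstep
    refine (T.geoDist_triangle z u z').trans
      ((add_le_add hstep (ih (Nat.le_of_succ_le hj) hu hy)).trans_eq ?_)
    rw [← ENNReal.ofReal_add (by linarith) (by linarith)]
    congr 1
    ring

theorem mem_skeleton_of_ridgeLine (hL : Layout c n m k ω ε) {j : ℕ} (hj : j + 1 < 2 * n)
    {z : unitSquare} (hz : (z : Plane) 0 = ridgeLine c n (j + 1)) : z ∈ T.skeleton := by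
  by_contra hskel
  have hmono := ridgeLine_strictMono hL.c_pos hL.one_le_n
  have hl : 0 ≤ ridgeLine c n j :=
    hL.ridgesWest_mem_Icc.1.trans (hL.ridgeLine_mem_Icc (by omega)).1
  have hu : ridgeLine c n (j + 1 + 1) ≤ 1 := (hL.ridgeLine_mem_Icc (by omega)).2
  have hlt : ridgeLine c n j < ridgeLine c n (j + 1) := hmono j.lt_succ_self
  have hlt' : ridgeLine c n (j + 1) < ridgeLine c n (j + 1 + 1) := hmono (j + 1).lt_succ_self
  have hmid : ∀ᶠ t : ℝ in nhdsWithin 0 (Set.Ioi 0),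
      T.height (z + t • pt 1 0) + T.height (z - t • pt 1 0) = 2 * T.height z :=
    (T.eventually_height_add_height_sub hskel _).filter_mono nhdsWithin_le_nhds
  obtain ⟨t, ⟨hmid, (ht : 0 < t)⟩, htw, hte⟩ := ((hmid.and self_mem_nhdsWithin).and
    (((gt_mem_nhds (sub_pos.2 hlt)).and (gt_mem_nhds (sub_pos.2 hlt'))).filter_mono
      nhdsWithin_le_nhds)).exists
  have hxe : ((z : Plane) + t • pt 1 0) 0 = ridgeLine c n (j + 1) + t := by simp [hz]
  have hxw : ((z : Plane) - t • pt 1 0) 0 = ridgeLine c n (j + 1) - t := by simp [hz]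
  have heast : (z : Plane) + t • pt 1 0 ∈ unitSquare := Fin.forall_fin_two.2
    ⟨by rw [hxe]; constructor <;> linarith, by simpa using z.2 1⟩
  have hwest : (z : Plane) - t • pt 1 0 ∈ unitSquare := Fin.forall_fin_two.2
    ⟨by rw [hxw]; constructor <;> linarith, by simpa using z.2 1⟩
  rcases Nat.even_or_odd j with he | ho
  · rw [hT.height_ridge_down (j + 1) hj he.add_one _ heast (by rw [hxe]; constructor <;> linarith),
      hT.height_ridge_up j (by omega) he _ hwest (by rw [hxw]; constructor <;> linarith),
      hT.height_ridge_up j (by omega) he _ z.2 ⟨by linarith, hz.le⟩, hxe, hxw, hz] at hmid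
    linarith [ridgeLine_succ c n j, ridgeLine_succ c n (j + 1)]
  · rw [hT.height_ridge_up (j + 1) hj ho.add_one _ heast (by rw [hxe]; constructor <;> linarith),
      hT.height_ridge_down j (by omega) ho _ hwest (by rw [hxw]; constructor <;> linarith),
      hT.height_ridge_down j (by omega) ho _ z.2 ⟨by linarith, hz.le⟩, hxe, hxw, hz] at hmid
    linarith [ridgeLine_succ c n j, ridgeLine_succ c n (j + 1)]

theorem geoDist_le_of_mem_farm {i : ℕ} (hi : i < k) {p q : unitSquare}
    (hp : (p : Plane) ∈ farm c m i) (hq : (q : Plane) ∈ farm c m i) :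
    T.geoDist p q ≤ ENNReal.ofReal (2 * farmSide c m) := by
  have hconv : Convex ℝ (farm c m i) := by
    rw [farm_eq_rect]
    exact convex_rect (convex_Icc _ _) (convex_Icc _ _)
  refine (T.geoDist_le_of_height_eq hconv (a := 0) (b := h) (fun r hr => ?_) hp hq).trans
    (ENNReal.ofReal_le_ofReal ?_)
  · rw [hT.height_farm_road i hi r (.inl hr), zero_mul, zero_add]
  · have hx : |(p : Plane) 0 - (q : Plane) 0| ≤ farmSide c m - 0 :=
      Real.dist_le_of_mem_Icc hp.1 hq.1
    have hy : |(p : Plane) 1 - (q : Plane) 1| ≤ farmSouth c m i + farmSide c m - farmSouth c m i :=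
      Real.dist_le_of_mem_Icc hp.2 hq.2
    rw [abs_zero]
    linarith

theorem geoDist_le_of_mem_road {i : ℕ} (hi : i < k) {p q : unitSquare}
    (hp : (p : Plane) ∈ road c n m ω i) (hq : (q : Plane) ∈ road c n m ω i) :
    T.geoDist p q ≤ ENNReal.ofReal
      (|(p : Plane) 0 - (q : Plane) 0| + |(p : Plane) 1 - (q : Plane) 1|) := by
  have hconv : Convex ℝ (road c n m ω i) := by
    rw [road_eq_rect]
    exact convex_rect (convex_Icc _ _) (convex_Icc _ _)
  simpa using T.geoDist_le_of_height_eq hconv (a := 0) (b := h)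
    (fun r hr => by rw [hT.height_farm_road i hi r (.inr hr), zero_mul, zero_add]) hp hq

theorem geoDist_le_of_ridgeLine_of_mem_farm (hL : Layout c n m k ω ε) {i j : ℕ} (hi : i < k)
    (hj : j ≤ 2 * n) {z q : unitSquare} (hz : (z : Plane) 0 = ridgeLine c n j)
    (hzi : (z : Plane) 1 = farmSouth c m i) (hq : (q : Plane) ∈ farm c m i) :
    T.geoDist z q ≤
      ENNReal.ofReal (2 * ridgesWidth c n + ridgesWest c n + farmSide c m) := by
  have hs := hL.side_pos
  have hsw : farmSide c m ≤ ridgesWest c n := by linarith [hL.gap, hL.ε_pos]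
  have hridge := hL.ridgeLine_mem_Icc hj
  have hwidth : ridgesWidth c n = 1 - ridgesWest c n := (sub_sub_cancel 1 _).symm
  have hsouth := hL.farmSouth_mem_Icc hi
  let u : unitSquare := ⟨pt (ridgesWest c n) (farmSouth c m i),
    pt_mem_unitSquare hL.ridgesWest_mem_Icc hsouth⟩
  let v : unitSquare := ⟨pt (farmSide c m) (farmSouth c m i),
    pt_mem_unitSquare ⟨hs.le, hsw.trans hL.ridgesWest_mem_Icc.2⟩ hsouth⟩
  have hridges : T.geoDist z u ≤ ENNReal.ofReal (2 * (ridgeLine c n j - ridgesWest c n)) :=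
    hT.geoDist_le_of_ridgeLine hL hj hz rfl hzi
  have hroad : T.geoDist u v ≤ ENNReal.ofReal (ridgesWest c n - farmSide c m) := by
    have hS : farmSouth c m i ∈ Set.Icc (farmSouth c m i) (farmSouth c m i + ω) :=
      ⟨le_rfl, le_add_of_nonneg_right hL.ω_nonneg⟩
    simpa [u, v, abs_of_nonneg (sub_nonneg.2 hsw)] using
      hT.geoDist_le_of_mem_road hi (p := u) (q := v) ⟨⟨hsw, le_rfl⟩, hS⟩ ⟨⟨le_rfl, hsw⟩, hS⟩
  have hfarm : T.geoDist v q ≤ ENNReal.ofReal (2 * farmSide c m) :=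
    hT.geoDist_le_of_mem_farm hi ⟨⟨hs.le, le_rfl⟩, le_rfl, le_add_of_nonneg_right hs.le⟩ hq
  calc T.geoDist z q ≤ T.geoDist z u + (T.geoDist u v + T.geoDist v q) :=
        (T.geoDist_triangle z u q).trans (add_le_add_right (T.geoDist_triangle u v q) _)
    _ ≤ ENNReal.ofReal (2 * (ridgeLine c n j - ridgesWest c n))
          + (ENNReal.ofReal (ridgesWest c n - farmSide c m)
            + ENNReal.ofReal (2 * farmSide c m)) :=
        add_le_add hridges (add_le_add hroad hfarm)
    _ = ENNReal.ofReal (2 * (ridgeLine c n j - ridgesWest c n)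
          + (ridgesWest c n - farmSide c m + 2 * farmSide c m)) := by
        rw [← ENNReal.ofReal_add (by linarith) (by linarith),
          ← ENNReal.ofReal_add (by linarith [hridge.1]) (by linarith)]
    _ ≤ _ := ENNReal.ofReal_le_ofReal (by linarith [hridge.2])

theorem ofReal_le_pathLength {j : ℕ} (hj : j < 2 * n) {z q : unitSquare}
    (hz : (z : Plane) 0 ∈ Set.Icc (ridgeLine c n j) (ridgeLine c n (j + 1)))
    (γ : Path z q) {t : unitInterval} (ht : T.height (γ t) = 0) :
    ENNReal.ofReal h ≤ T.pathLength γ := by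
  refine le_trans (ENNReal.ofReal_le_ofReal ?_)
    ((T.ofReal_abs_sub_le_edist_lift (γ 0) (γ t) 2).trans (T.edist_lift_le_pathLength γ 0 t))
  rw [T.lift_two, T.lift_two, ht, γ.source, sub_zero]
  exact (hT.le_height_of_mem_ridge hj z.2 hz).trans (le_abs_self _)

theorem exists_near_of_height_ne_zero {p : Plane} (hp : p ∈ unitSquare)
    (hpw : p 0 + ε ≤ ridgesWest c n) (h0 : T.height p ≠ 0) :
    ∃ b < k, ∃ r ∈ farm c m b ∪ road c n m ω b, |p 0 - r 0| < ε ∧ |p 1 - r 1| < ε := by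
  obtain ⟨r, hr, hlt⟩ : ∃ r ∈ builtArea c n m k ω, dist p r < ε := by
    by_contra! hfar
    exact h0 (hT.height_forbidden p hp hfar)
  have hnear (i : Fin 2) : |p i - r i| < ε := by
    rw [dist_eq_norm] at hlt
    exact (PiLp.norm_apply_le (p - r) i).trans_lt hlt
  rcases hr with hr | hr
  · obtain ⟨b, hb, hr⟩ := Set.mem_iUnion₂.1 hr
    exact ⟨b, hb, r, hr, hnear 0, hnear 1⟩
  · linarith [(abs_lt.1 (hnear 0)).1, hr.2]

theorem exists_mem_Ioo_of_height_ne_zero (hω : ω ≤ farmSide c m) {p : Plane}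
    (hp : p ∈ unitSquare) (hpw : p 0 + ε ≤ ridgesWest c n) (h0 : T.height p ≠ 0) :
    ∃ b < k, p 1 ∈ Set.Ioo (farmSouth c m b - ε) (farmSouth c m b + farmSide c m + ε) := by
  obtain ⟨b, hb, r, hr, -, hy⟩ := hT.exists_near_of_height_ne_zero hp hpw h0
  have hr1 : r 1 ∈ Set.Icc (farmSouth c m b) (farmSouth c m b + farmSide c m) :=
    hr.elim (·.2) fun hr => ⟨hr.2.1, hr.2.2.trans (add_le_add_right hω _)⟩
  have hy := abs_lt.1 hy
  exact ⟨b, hb, by linarith [hr1.1], by linarith [hr1.2]⟩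

theorem exists_mem_Ioo_road_of_height_ne_zero {p : Plane} (hp : p ∈ unitSquare)
    (hpf : farmSide c m + ε ≤ p 0) (hpw : p 0 + ε ≤ ridgesWest c n) (h0 : T.height p ≠ 0) :
    ∃ b < k, p 1 ∈ Set.Ioo (farmSouth c m b - ε) (farmSouth c m b + ω + ε) := by
  obtain ⟨b, hb, r, hr, hx, hy⟩ := hT.exists_near_of_height_ne_zero hp hpw h0
  have hy := abs_lt.1 hy
  rcases hr with hr | hr
  · linarith [(abs_lt.1 hx).2, hr.1.2]
  · exact ⟨b, hb, by linarith [hr.2.1], by linarith [hr.2.2]⟩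

/-- After the path has left the ridges for the last time, it can no longer change from one farm and
its road to another. -/
theorem exists_crossing_road (hA : Admissible c n m k ω ε h) {l : ℕ} {z q : unitSquare}
    (hz : ridgesWest c n ≤ (z : Plane) 0) (hq : (q : Plane) ∈ farm c m l) (γ : Path z q)
    (hγ : ∀ t, T.height (γ t) ≠ 0) :
    ∃ σ, (γ σ : Plane) 0 = ridgesWest c n - 2 * ε ∧
      (γ σ : Plane) 1 ∈ Set.Ioo (farmSouth c m l - ε) (farmSouth c m l + ω + ε) := by
  have hε := hA.ε_pos
  have hω := hA.ω_nonneg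
  have hs := hA.side_pos
  have hgap := hA.gap
  have hnarrow := hA.narrow
  have hwidth := ridgesWidth_pos hA.c_pos n
  obtain ⟨σ, hσ, hwest⟩ := exists_last_eq (continuous_path_coord γ 0)
    (a := ridgesWest c n - 2 * ε) (by rw [γ.source]; linarith)
    (by rw [γ.target]; linarith [hq.1.2])
  have hbetween : ∀ t ∈ Set.Ici σ, (γ t : Plane) 1 ≠ farmSouth c m l - farmSide c m ∧
      (γ t : Plane) 1 ≠ farmSouth c m l + 2 * farmSide c m := fun t ht =>
    have ⟨_, _, hb⟩ := hT.exists_mem_Ioo_of_height_ne_zero (by linarith) (γ t).2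
      (by linarith [hwest t ht]) (hγ t)
    ne_between_farms hs (by linarith) hb
  have hmem : (γ σ : Plane) 1 ∈
      Set.Ioo (farmSouth c m l - farmSide c m) (farmSouth c m l + 2 * farmSide c m) :=
    mem_Ioo_of_isPreconnected isPreconnected_Ici (continuous_path_coord γ 1).continuousOn
      (fun t ht => (hbetween t ht).1) (fun t ht => (hbetween t ht).2) (x := 1) unitInterval.le_one'
      Set.self_mem_Ici
      (by rw [γ.target]; exact ⟨by linarith [hq.2.1], by linarith [hq.2.2]⟩)
  obtain ⟨b, -, hb⟩ := hT.exists_mem_Ioo_road_of_height_ne_zero (γ σ).2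
    (by linarith) (by linarith) (hγ σ)
  obtain rfl : b = l := eq_of_abs_farmSouth_sub_lt hs.le
    (abs_lt.2 ⟨by linarith [hb.2, hmem.1], by linarith [hb.1, hmem.2]⟩)
  exact ⟨σ, hσ, hb⟩

theorem le_pathLength_of_mem_farm (hA : Admissible c n m k ω ε h) {i l : ℕ} (hil : i ≠ l)
    {z q : unitSquare} (hz : ridgesWest c n ≤ (z : Plane) 0)
    (hzi : (z : Plane) 1 = farmSouth c m i) (hq : (q : Plane) ∈ farm c m l) (γ : Path z q)
    (hγ : ∀ t, T.height (γ t) ≠ 0) :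
    ENNReal.ofReal (ridgesWest c n + 2 * farmSide c m - 3 * ε - ω) ≤ T.pathLength γ := by
  obtain ⟨σ, hσx, hσy⟩ := hT.exists_crossing_road hA hz hq γ hγ
  have hdy : 3 * farmSide c m - ω - ε ≤ |(z : Plane) 1 - (γ σ : Plane) 1| := by
    have hgap := three_mul_farmSide_le_abs_sub hA.side_pos.le hil
    have hclose : |farmSouth c m l - (γ σ : Plane) 1| ≤ ω + ε :=
      abs_le.2 ⟨by linarith [hσy.2], by linarith [hσy.1, hA.ω_nonneg]⟩
    have htri := abs_sub_le (farmSouth c m i) ((γ σ : Plane) 1) (farmSouth c m l)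
    rw [abs_sub_comm ((γ σ : Plane) 1)] at htri
    rw [hzi]
    linarith
  have hdx : ridgesWest c n - 2 * ε - farmSide c m ≤ |(γ σ : Plane) 0 - (q : Plane) 0| := by
    rw [hσx]
    exact le_trans (by linarith [hq.1.2]) (le_abs_self _)
  calc ENNReal.ofReal (ridgesWest c n + 2 * farmSide c m - 3 * ε - ω)
      ≤ ENNReal.ofReal (|(z : Plane) 1 - (γ σ : Plane) 1| + |(γ σ : Plane) 0 - (q : Plane) 0|) :=
        ENNReal.ofReal_le_ofReal (by linarith)
    _ ≤ edist (T.lift z) (T.lift (γ σ)) + edist (T.lift (γ σ)) (T.lift q) := by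
        rw [ENNReal.ofReal_add (abs_nonneg _) (abs_nonneg _)]
        exact add_le_add (T.ofReal_abs_sub_le_edist_lift _ _ 1)
          (T.ofReal_abs_sub_le_edist_lift _ _ 0)
    _ ≤ T.pathLength γ := T.edist_lift_add_le_pathLength γ σ

theorem mem_farm_of_mem_cell (hA : Admissible c n m k ω ε h) {M : ℕ} {P : Fin M → unitSquare}
    (hP : ∀ a, T.height (P a) = 0 ∨ ∃ l < k, (P a : Plane) ∈ farm c m l) {i j : ℕ} (hi : i < k)
    (hocc : ∃ a, (P a : Plane) ∈ farm c m i) (hj : j < 2 * n) {z : unitSquare}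
    (hz : (z : Plane) 0 = ridgeLine c n j) (hzi : (z : Plane) 1 = farmSouth c m i) {a : Fin M}
    (ha : z ∈ T.cell P a) : (P a : Plane) ∈ farm c m i := by
  have hwidth := ridgesWidth_pos hA.c_pos n
  have hwest := hA.ridgesWest_mem_Icc
  have hsw := hA.gap
  have hnarrow := hA.narrow
  have hhigh := hA.high
  have hε := hA.ε_pos
  have hω := hA.ω_nonneg
  obtain ⟨b, hb⟩ := hocc
  have hle := (ha b).trans (hT.geoDist_le_of_ridgeLine_of_mem_farm hA.toLayout hi hj.le hz hzi hb)
  by_contra hout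
  have hlong : ENNReal.ofReal (min h (ridgesWest c n + 2 * farmSide c m - 3 * ε - ω)) ≤
      T.geoDist z (P a) := by
    refine le_iInf fun γ => ?_
    by_cases hγ : ∃ t, T.height (γ t) = 0
    · obtain ⟨t, ht⟩ := hγ
      have hlt := (ridgeLine_strictMono hA.c_pos hA.one_le_n j.lt_succ_self).le
      exact (ENNReal.ofReal_le_ofReal (min_le_left _ _)).trans
        (hT.ofReal_le_pathLength hj ⟨hz.ge, hz.trans_le hlt⟩ γ ht)
    · push Not at hγ
      obtain ⟨l, -, hl⟩ := (hP a).resolve_left (γ.target ▸ hγ 1)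
      have hil : i ≠ l := by
        rintro rfl
        exact hout hl
      exact (ENNReal.ofReal_le_ofReal (min_le_right _ _)).trans
        (hT.le_pathLength_of_mem_farm hA hil (hz ▸ (hA.ridgeLine_mem_Icc hj.le).1) hzi hl γ hγ)
  exact (hlong.trans hle).not_gt
    ((ENNReal.ofReal_lt_ofReal_iff_of_nonneg (by linarith [hwest.1])).2
      (lt_min (by linarith [hwest.2]) (by linarith)))

end IsFarmingTerrain

theorem exists_mem_inter_of_isClosed_cover {X ι : Type*} [ConditionallyCompleteLinearOrder X]
    [TopologicalSpace X] [OrderTopology X] [DenselyOrdered X] [Finite ι] {C : ι → Set X}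
    (hC : ∀ a, IsClosed (C a)) (hcover : ∀ y, ∃ a, y ∈ C a) {I : Set ι} {u v : X} (huv : u ≤ v)
    (hu : ∀ a, u ∈ C a → a ∉ I) (hv : ∀ a, v ∈ C a → a ∈ I) :
    ∃ y ∈ Set.Ioo u v, ∃ a ∈ I, ∃ b ∉ I, y ∈ C a ∧ y ∈ C b := by
  have hclosed (J : Set ι) : IsClosed (⋃ a ∈ J, C a) :=
    J.toFinite.isClosed_biUnion fun a _ => hC a
  have hunion (y : X) : y ∈ (⋃ a ∈ I, C a) ∪ ⋃ a ∈ Iᶜ, C a := by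
    obtain ⟨a, ha⟩ := hcover y
    by_cases haI : a ∈ I
    · exact .inl (Set.mem_biUnion haI ha)
    · exact .inr (Set.mem_biUnion haI ha)
  obtain ⟨y, hy, hyI, hyJ⟩ := isPreconnected_closed_iff.1 (isPreconnected_Icc (a := u) (b := v))
    _ _ (hclosed I) (hclosed Iᶜ) (fun y _ => hunion y)
    (have ⟨a, ha⟩ := hcover v; ⟨v, ⟨huv, le_rfl⟩, Set.mem_biUnion (hv a ha) ha⟩)
    (have ⟨a, ha⟩ := hcover u; ⟨u, ⟨le_rfl, huv⟩, Set.mem_biUnion (hu a ha) ha⟩)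
  obtain ⟨a, haI, ha⟩ := Set.mem_iUnion₂.1 hyI
  obtain ⟨b, hbI, hb⟩ := Set.mem_iUnion₂.1 hyJ
  refine ⟨y, ⟨hy.1.lt_of_ne ?_, hy.2.lt_of_ne ?_⟩, a, haI, b, hbI, ha, hb⟩
  · rintro rfl
    exact hu a ha haI
  · rintro rfl
    exact hbI (hv b hb)

theorem injective_of_mem_Ioo_rows {α : Type*} {N : ℕ} {F : α × Fin N → Plane} {ξ : α → ℝ}
    (hξ : Function.Injective ξ) {η : Fin (N + 1) → ℝ} (hη : Antitone η)
    (hx : ∀ a, F a 0 = ξ a.1) (hy : ∀ a, F a 1 ∈ Set.Ioo (η a.2.succ) (η a.2.castSucc)) :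
    Function.Injective F := by
  have hlt {a b : α × Fin N} (hab : a.2 < b.2) : F b 1 < F a 1 :=
    (hy b).2.trans_le ((hη (Fin.succ_le_castSucc_iff.2 hab)).trans (hy a).1.le)
  intro a b hab
  refine Prod.ext (hξ ?_) ?_
  · rw [← hx, ← hx, hab]
  · rcases lt_trichotomy a.2 b.2 with h | h | h
    · exact absurd (hlt h) (hab ▸ lt_irrefl _)
    · exact h
    · exact absurd (hlt h) (hab ▸ lt_irrefl _)

theorem eq_of_mem_farm {c : ℝ} {m i l : ℕ} (hs : 0 < farmSide c m) {p : Plane}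
    (hi : p ∈ farm c m i) (hl : p ∈ farm c m l) : i = l :=
  eq_of_abs_farmSouth_sub_lt hs.le
    (abs_lt.2 ⟨by linarith [hi.2.2, hl.2.1], by linarith [hi.2.1, hl.2.2]⟩)

theorem Terrain.exists_mem_cell (T : Terrain) {M : ℕ} [NeZero M] (P : Fin M → unitSquare)
    (z : unitSquare) : ∃ a, z ∈ T.cell P a :=
  Finite.exists_min fun a => T.geoDist z (P a)

open scoped Classical in
/-- The indices of the farms that contain at least one of the sites. -/
def occupied (c : ℝ) (m k : ℕ) {M : ℕ} (P : Fin M → unitSquare) : Finset ℕ :=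
  {i ∈ Finset.range k | ∃ a, (P a : Plane) ∈ farm c m i}

theorem mem_occupied {c : ℝ} {m k : ℕ} {M : ℕ} {P : Fin M → unitSquare} {i : ℕ} :
    i ∈ occupied c m k P ↔ i < k ∧ ∃ a, (P a : Plane) ∈ farm c m i := by
  simp [occupied]

namespace IsFarmingTerrain

variable {T : Terrain} {c : ℝ} {n m k : ℕ} {ω ε h : ℝ}
  (hT : IsFarmingTerrain T c n m k ω ε h)

include hT

theorem continuousOn_geoDist_ridge {j : ℕ} (hj : j < 2 * n) (q : unitSquare) :
    ContinuousOn (fun z => T.geoDist z q)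
      {z : unitSquare | (z : Plane) 0 ∈ Set.Icc (ridgeLine c n j) (ridgeLine c n (j + 1))} := by
  rw [continuousOn_iff_continuous_domRestrict]
  refine continuous_of_le_add_edist 3 (by simp) fun z z' => ?_
  have hcoord (i : Fin 2) : |(z : Plane) i - (z' : Plane) i| ≤ dist z z' :=
    PiLp.norm_apply_le ((z : Plane) - (z' : Plane)) i
  calc T.geoDist z q ≤ T.geoDist z z' + T.geoDist z' q := T.geoDist_triangle z z' q
    _ ≤ ENNReal.ofReal (3 * dist z z') + T.geoDist z' q := by
        gcongr
        exact (hT.geoDist_le_of_mem_ridge hj z.2 z'.2).trans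
          (ENNReal.ofReal_le_ofReal (by linarith [hcoord 0, hcoord 1]))
    _ = T.geoDist z' q + 3 * edist z z' := by
        rw [add_comm, ENNReal.ofReal_mul zero_le_three, ← edist_dist, ENNReal.ofReal_ofNat]

variable (hA : Admissible c n m k ω ε h) {M : ℕ} {P : Fin M → unitSquare}
  (hP : ∀ a, T.height (P a) = 0 ∨ ∃ l < k, (P a : Plane) ∈ farm c m l)

include hA hP

/-- Walking along the ridge line from the height of one farm to that of another, the nearest site
changes from a site of a farm `b ≤ i` to another one; at the change two cells meet. -/
theorem exists_two_le_incident {i l : ℕ} (hil : i < l) (hi : i ∈ occupied c m k P)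
    (hl : l ∈ occupied c m k P) {j : ℕ} (hj : j < 2 * n) :
    ∃ z : unitSquare, (z : Plane) 0 = ridgeLine c n j ∧
      (z : Plane) 1 ∈ Set.Ioo (farmSouth c m l) (farmSouth c m i) ∧
      2 ≤ (T.incident P z).encard := by
  rw [mem_occupied] at hi hl
  have : NeZero M := ⟨fun h0 => (h0 ▸ hi.2.choose : Fin 0).elim0⟩
  let f : unitInterval → unitSquare := fun y =>
    ⟨pt (ridgeLine c n j) y, hA.pt_ridgeLine_mem_unitSquare hj.le y.2⟩
  have hf : Continuous f := Continuous.subtype_mk (by unfold pt; fun_prop) _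
  have hdist (q : unitSquare) : Continuous fun y => T.geoDist (f y) q :=
    (hT.continuousOn_geoDist_ridge hj q).comp_continuous hf fun _ =>
      ⟨le_rfl, (ridgeLine_strictMono hA.c_pos hA.one_le_n j.lt_succ_self).le⟩
  have hclosed (a : Fin M) : IsClosed {y | f y ∈ T.cell P a} := by
    change IsClosed {y | ∀ b, T.geoDist (f y) (P a) ≤ T.geoDist (f y) (P b)}
    simp only [Set.ofPred_forall]
    exact isClosed_iInter fun b => isClosed_le (hdist (P a)) (hdist (P b))
  obtain ⟨y, hy, a, haI, b, hbI, ha, hb⟩ := exists_mem_inter_of_isClosed_cover hclosed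
    (fun y => T.exists_mem_cell P (f y)) (I := {a | ∃ b ≤ i, (P a : Plane) ∈ farm c m b})
    (u := ⟨farmSouth c m l, hA.farmSouth_mem_Icc hl.1⟩)
    (v := ⟨farmSouth c m i, hA.farmSouth_mem_Icc hi.1⟩)
    (farmSouth_strictAnti hA.side_pos hil).le
    (fun a ha ⟨b, hb, hab⟩ => (hb.trans_lt hil).ne (eq_of_mem_farm hA.side_pos hab
      (hT.mem_farm_of_mem_cell hA hP hl.1 hl.2 hj rfl rfl ha)))
    (fun a ha => ⟨i, le_rfl, hT.mem_farm_of_mem_cell hA hP hi.1 hi.2 hj rfl rfl ha⟩)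
  exact ⟨f y, rfl, hy, Order.add_one_le_of_lt (Set.one_lt_encard_iff.2
    ⟨a, b, ha, hb, fun hab => hbI (hab ▸ haI)⟩)⟩

theorem mul_card_occupied_le :
    (((2 * n - 1) * ((occupied c m k P).card - 1) : ℕ) : ℕ∞) ≤ T.voronoiComplexity P := by
  rcases hcard : (occupied c m k P).card with _ | N
  · simp
  let σ := (occupied c m k P).orderEmbOfFin hcard
  have hσ (r) : σ r ∈ occupied c m k P := Finset.orderEmbOfFin_mem _ _ r
  have hex (x : Fin (2 * n - 1) × Fin N) : ∃ z : unitSquare,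
      (z : Plane) 0 = ridgeLine c n (x.1 + 1) ∧
      (z : Plane) 1 ∈ Set.Ioo (farmSouth c m (σ x.2.succ)) (farmSouth c m (σ x.2.castSucc)) ∧
      2 ≤ (T.incident P z).encard :=
    hT.exists_two_le_incident hA hP (σ.strictMono x.2.castSucc_lt_succ) (hσ _) (hσ _) (by omega)
  choose F hFx hFy hF using hex
  have hridge : Function.Injective fun a : Fin (2 * n - 1) => ridgeLine c n (a + 1) :=
    (ridgeLine_strictMono hA.c_pos hA.one_le_n).injective.comp
      ((Nat.succ_injective).comp Fin.val_injective)
  have hinj : Function.Injective F :=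
    (injective_of_mem_Ioo_rows (F := fun x => (F x : Plane)) hridge
      (η := fun r => farmSouth c m (σ r))
      ((farmSouth_strictAnti hA.side_pos).antitone.comp_monotone σ.monotone) hFx hFy).of_comp
      (f := Subtype.val)
  calc (((2 * n - 1) * N : ℕ) : ℕ∞) = (Set.range F).encard := by
        rw [← Set.image_univ, hinj.encard_image, Set.encard_univ, ENat.card_eq_coe_fintype_card]
        simp
    _ ≤ {z | z ∈ T.skeleton ∧ 2 ≤ (T.incident P z).encard}.encard :=
        Set.encard_le_encard (Set.range_subset_iff.2 fun x =>
          ⟨hT.mem_skeleton_of_ridgeLine hA.toLayout (by omega) (hFx x), hF x⟩)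
    _ ≤ T.voronoiComplexity P := T.encard_le_voronoiComplexity P

end IsFarmingTerrain

section Measure

open MeasureTheory

theorem measurable_unitSquare_coord (i : Fin 2) :
    Measurable fun p : unitSquare => (p : Plane) i :=
  (show Measurable fun p : Plane => p i by fun_prop).comp measurable_subtype_coe

theorem volume_rect (A B : Set ℝ) : volume (rect A B) = volume A * volume B := by
  have hrect : rect A B =
      (MeasurableEquiv.toLp 2 (Fin 2 → ℝ)).symm ⁻¹' Set.univ.pi ![A, B] := by
    ext p
    simp [rect]
  rw [hrect, (EuclideanSpace.volume_preserving_symm_measurableEquiv_toLp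
    (Fin 2)).measure_preimage_equiv, volume_pi_pi, Fin.prod_univ_two]
  rfl

theorem measurableSet_unitSquare : MeasurableSet unitSquare := by
  simp only [unitSquare, Set.ofPred_forall]
  exact .iInter fun i => (show Measurable fun p : Plane => p i by fun_prop) measurableSet_Icc

theorem uniformSquare_preimage_rect (A B : Set ℝ) :
    uniformSquare (Subtype.val ⁻¹' rect A B) =
      volume (A ∩ Set.Icc 0 1) * volume (B ∩ Set.Icc 0 1) := by
  rw [uniformSquare, (MeasurableEmbedding.subtype_coe measurableSet_unitSquare).comap_apply,
    Subtype.image_preimage_coe, ← volume_rect, unitSquare_eq_rect]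
  congr 1
  ext p
  simp only [rect, Set.mem_inter_iff, Set.mem_ofPred_eq]
  tauto

instance : IsProbabilityMeasure uniformSquare := ⟨by
  simpa [rect] using uniformSquare_preimage_rect Set.univ Set.univ⟩

instance (m : ℕ) : IsProbabilityMeasure (siteLaw m) :=
  inferInstanceAs (IsProbabilityMeasure (Measure.pi _))

/-- The points of the square whose `i`-th coordinate lies between `a` and `b`. -/
def strip (i : Fin 2) (a b : ℝ) : Set unitSquare := {p | (p : Plane) i ∈ Set.Icc a b}

theorem measurableSet_strip (i : Fin 2) (a b : ℝ) : MeasurableSet (strip i a b) :=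
  measurable_unitSquare_coord i measurableSet_Icc

theorem uniformSquare_strip_le (i : Fin 2) (a b : ℝ) :
    uniformSquare (strip i a b) ≤ ENNReal.ofReal (b - a) := by
  have hinter : volume (Set.Icc a b ∩ Set.Icc 0 1) ≤ ENNReal.ofReal (b - a) :=
    (measure_mono Set.inter_subset_left).trans_eq Real.volume_Icc
  fin_cases i
  · have := uniformSquare_preimage_rect (Set.Icc a b) Set.univ
    simp only [rect, Set.mem_univ, and_true, Set.univ_inter, Real.volume_Icc, sub_zero,
      ENNReal.ofReal_one, mul_one] at this
    exact this.trans_le hinter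
  · have := uniformSquare_preimage_rect Set.univ (Set.Icc a b)
    simp only [rect, Set.mem_univ, true_and, Set.univ_inter, Real.volume_Icc, sub_zero,
      ENNReal.ofReal_one, one_mul] at this
    exact this.trans_le hinter

/-- Thin strips around the ridges and along the sides of the farms and roads. A point of the square
outside of them is on a farm or at height `0`. -/
def badStrips (c : ℝ) (n m k : ℕ) (ω ε : ℝ) : Set unitSquare :=
  strip 0 (ridgesWest c n - ε) 1 ∪ strip 0 (farmSide c m) (farmSide c m + ε) ∪
    ⋃ i ∈ Finset.range k, (strip 1 (farmSouth c m i - ε) (farmSouth c m i + ω + ε) ∪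
      strip 1 (farmSouth c m i + farmSide c m) (farmSouth c m i + farmSide c m + ε))

theorem measurableSet_badStrips (c : ℝ) (n m k : ℕ) (ω ε : ℝ) :
    MeasurableSet (badStrips c n m k ω ε) :=
  .union (.union (measurableSet_strip ..) (measurableSet_strip ..))
    (Finset.measurableSet_biUnion _ fun _ _ =>
      .union (measurableSet_strip ..) (measurableSet_strip ..))

theorem measure_union_le_ofReal {α : Type*} [MeasurableSpace α] {μ : Measure α} {A B : Set α}
    {a b : ℝ} (ha : 0 ≤ a) (hb : 0 ≤ b) (hA : μ A ≤ ENNReal.ofReal a)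
    (hB : μ B ≤ ENNReal.ofReal b) : μ (A ∪ B) ≤ ENNReal.ofReal (a + b) :=
  (measure_union_le A B).trans ((add_le_add hA hB).trans_eq (ENNReal.ofReal_add ha hb).symm)

theorem measure_biUnion_range_le_ofReal {α : Type*} [MeasurableSpace α] {μ : Measure α}
    {A : ℕ → Set α} {k : ℕ} {a : ℝ} (hA : ∀ i, μ (A i) ≤ ENNReal.ofReal a) :
    μ (⋃ i ∈ Finset.range k, A i) ≤ ENNReal.ofReal (k * a) :=
  calc μ (⋃ i ∈ Finset.range k, A i) ≤ ∑ i ∈ Finset.range k, μ (A i) :=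
        measure_biUnion_finset_le _ _
    _ ≤ ∑ _i ∈ Finset.range k, ENNReal.ofReal a := Finset.sum_le_sum fun i _ => hA i
    _ = ENNReal.ofReal (k * a) := by
        rw [Finset.sum_const, Finset.card_range, nsmul_eq_mul, ENNReal.ofReal_mul k.cast_nonneg,
          ENNReal.ofReal_natCast]

theorem uniformSquare_badStrips_le {c : ℝ} {n : ℕ} (m k : ℕ) {ω ε : ℝ}
    (hW : 0 ≤ ridgesWidth c n) (hω : 0 ≤ ω) (hε : 0 ≤ ε) :
    uniformSquare (badStrips c n m k ω ε) ≤
      ENNReal.ofReal (ridgesWidth c n + 2 * ε + k * (ω + 3 * ε)) := by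
  have hstrip {i : Fin 2} {a b d : ℝ} (hd : b - a = d) :
      uniformSquare (strip i a b) ≤ ENNReal.ofReal d := hd ▸ uniformSquare_strip_le i a b
  have hfarm (i : ℕ) : uniformSquare
      (strip 1 (farmSouth c m i - ε) (farmSouth c m i + ω + ε) ∪
        strip 1 (farmSouth c m i + farmSide c m) (farmSouth c m i + farmSide c m + ε)) ≤
      ENNReal.ofReal (ω + 2 * ε + ε) :=
    measure_union_le_ofReal (by positivity) hε (hstrip (by ring)) (hstrip (by ring))
  have hridges : uniformSquare (strip 0 (ridgesWest c n - ε) 1) ≤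
      ENNReal.ofReal (ridgesWidth c n + ε) := hstrip (by rw [ridgesWest]; ring)
  refine (measure_union_le_ofReal (by positivity) (by positivity) (measure_union_le_ofReal
    (by positivity) hε hridges (hstrip (add_sub_cancel_left _ _)))
    (measure_biUnion_range_le_ofReal hfarm)).trans_eq ?_
  congr 1
  ring

theorem IsFarmingTerrain.height_eq_zero_or_mem_farm {T : Terrain} {c : ℝ} {n m k : ℕ}
    {ω ε h : ℝ} (hT : IsFarmingTerrain T c n m k ω ε h) (hω : 0 ≤ ω) {p : unitSquare}
    (hp : p ∉ badStrips c n m k ω ε) : T.height p = 0 ∨ ∃ l < k, (p : Plane) ∈ farm c m l := by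
  refine or_iff_not_imp_left.2 fun h0 => ?_
  simp only [badStrips, strip, Set.mem_union, Set.mem_iUnion, Set.mem_ofPred_eq,
    Finset.mem_range, not_or, not_exists, Set.mem_Icc, not_and, not_le] at hp
  obtain ⟨⟨hridges, heast⟩, hfarm⟩ := hp
  have hwest : (p : Plane) 0 + ε ≤ ridgesWest c n := by
    by_contra! hlt
    exact (hridges (by linarith)).not_ge (p.2 0).2
  obtain ⟨b, hb, r, hr, hx, hy⟩ := hT.exists_near_of_height_ne_zero p.2 hwest h0
  rw [abs_lt] at hx hy
  obtain ⟨hsouth, hnorth⟩ := hfarm b hb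
  have hr_south : farmSouth c m b ≤ r 1 := hr.elim (·.2.1) (·.2.1)
  have hp_south := hsouth (by linarith)
  have hr_farm : r ∈ farm c m b := hr.resolve_right fun hr => by linarith [hr.2.2]
  refine ⟨b, hb, ⟨(p.2 0).1, ?_⟩, by linarith, ?_⟩
  · by_contra! hlt
    linarith [heast hlt.le, hr_farm.1.2]
  · by_contra! hlt
    linarith [hnorth hlt.le, hr_farm.2.2]

/-- The event that the `i`-th farm contains a site. -/
def occupiedEvent (c : ℝ) (m i : ℕ) : Set (Fin m → unitSquare) :=
  {P | ∃ a, (P a : Plane) ∈ farm c m i}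

/-- The event that no site is in a bad strip. -/
def goodEvent (c : ℝ) (n m k : ℕ) (ω ε : ℝ) : Set (Fin m → unitSquare) :=
  {P | ∀ a, P a ∉ badStrips c n m k ω ε}

theorem measurableSet_preimage_farm (c : ℝ) (m i : ℕ) :
    MeasurableSet ((↑) ⁻¹' farm c m i : Set unitSquare) :=
  (measurable_unitSquare_coord 0 measurableSet_Icc).inter
    (measurable_unitSquare_coord 1 measurableSet_Icc)

theorem measurableSet_occupiedEvent (c : ℝ) (m i : ℕ) :
    MeasurableSet (occupiedEvent c m i) := by
  simp only [occupiedEvent, Set.ofPred_exists]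
  exact .iUnion fun a => (measurableSet_preimage_farm c m i).preimage (measurable_pi_apply a)

theorem measurableSet_goodEvent (c : ℝ) (n m k : ℕ) (ω ε : ℝ) :
    MeasurableSet (goodEvent c n m k ω ε) := by
  simp only [goodEvent, Set.ofPred_forall]
  exact .iInter fun a =>
    (measurableSet_badStrips c n m k ω ε).compl.preimage (measurable_pi_apply a)

theorem siteLaw_compl_goodEvent_le {c : ℝ} {n : ℕ} (m k : ℕ) {ω ε : ℝ}
    (hW : 0 ≤ ridgesWidth c n) (hω : 0 ≤ ω) (hε : 0 ≤ ε) :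
    siteLaw m (goodEvent c n m k ω ε)ᶜ ≤
      ENNReal.ofReal (m * (ridgesWidth c n + 2 * ε + k * (ω + 3 * ε))) := by
  have hcompl : (goodEvent c n m k ω ε)ᶜ = ⋃ a, Function.eval a ⁻¹' badStrips c n m k ω ε := by
    ext P
    simp [goodEvent]
  have heval (a : Fin m) : siteLaw m (Function.eval a ⁻¹' badStrips c n m k ω ε) =
      uniformSquare (badStrips c n m k ω ε) :=
    (measurePreserving_eval (fun _ => uniformSquare) a).measure_preimage
      (measurableSet_badStrips c n m k ω ε).nullMeasurableSet
  calc siteLaw m (goodEvent c n m k ω ε)ᶜ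
      ≤ ∑ a : Fin m, siteLaw m (Function.eval a ⁻¹' badStrips c n m k ω ε) :=
        hcompl ▸ measure_iUnion_fintype_le _ _
    _ = m * uniformSquare (badStrips c n m k ω ε) := by simp [heval]
    _ ≤ _ := by
        rw [ENNReal.ofReal_mul m.cast_nonneg, ENNReal.ofReal_natCast]
        gcongr
        exact uniformSquare_badStrips_le m k hW hω hε

theorem mul_farmSide_sq (c : ℝ) {m : ℕ} (hm : m ≠ 0) : m * farmSide c m ^ 2 = 1 / c ^ 2 := by
  rw [farmSide, div_pow, mul_pow, Real.sq_sqrt m.cast_nonneg]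
  field_simp

theorem uniformSquare_farm {c : ℝ} {m k i : ℕ} (hs : 0 < farmSide c m)
    (hk : 3 * k * farmSide c m ≤ 1) (hi : i < k) :
    uniformSquare (Subtype.val ⁻¹' farm c m i) = ENNReal.ofReal (farmSide c m ^ 2) := by
  have hlow := farmSide_le_farmSouth hs hk hi
  have hup := farmSouth_add_le_one hs i
  rw [farm_eq_rect, uniformSquare_preimage_rect,
    Set.inter_eq_left.2 (Set.Icc_subset_Icc le_rfl (by linarith)),
    Set.inter_eq_left.2 (Set.Icc_subset_Icc (by linarith) (by linarith)), Real.volume_Icc,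
    Real.volume_Icc, ← ENNReal.ofReal_mul (by linarith), sub_zero, add_sub_cancel_left, sq]

/-- A lower bound for the probability that a given farm contains a site. -/
def occupancy (c : ℝ) : ℝ := 1 - Real.exp (-(1 / c ^ 2))

theorem siteLaw_compl_occupiedEvent_le {c : ℝ} {m k : ℕ} (hm : m ≠ 0) (hs : 0 < farmSide c m)
    (hk : 3 * k * farmSide c m ≤ 1) {i : ℕ} (hi : i < k) :
    siteLaw m (occupiedEvent c m i)ᶜ ≤ ENNReal.ofReal (1 - occupancy c) := by
  have hcompl : (occupiedEvent c m i)ᶜ =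
      Set.univ.pi fun _ : Fin m => (Subtype.val ⁻¹' farm c m i)ᶜ := by
    ext P
    simp [occupiedEvent]
  have hs1 : farmSide c m ^ 2 ≤ 1 := by
    nlinarith [farmSide_le_farmSouth hs hk hi, farmSouth_add_le_one hs i]
  rw [hcompl, siteLaw, Measure.pi_pi, Finset.prod_const, Finset.card_univ, Fintype.card_fin,
    prob_compl_eq_one_sub (measurableSet_preimage_farm c m i), uniformSquare_farm hs hk hi,
    ← ENNReal.ofReal_one, ← ENNReal.ofReal_sub _ (by positivity),
    ← ENNReal.ofReal_pow (by linarith)]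
  refine ENNReal.ofReal_le_ofReal ?_
  calc (1 - farmSide c m ^ 2) ^ m ≤ Real.exp (-(farmSide c m ^ 2)) ^ m :=
        pow_le_pow_left₀ (by linarith) (Real.one_sub_le_exp_neg _) m
    _ = 1 - occupancy c := by
        rw [← Real.exp_nat_mul, mul_neg, mul_farmSide_sq c hm, occupancy, sub_sub_cancel]

theorem one_sub_le_measure_inter {α : Type*} [MeasurableSpace α] (μ : Measure α)
    [IsProbabilityMeasure μ] (A B : Set α) : 1 - (μ Aᶜ + μ Bᶜ) ≤ μ (A ∩ B) := by
  rw [tsub_le_iff_right, ← measure_univ (μ := μ), ← Set.union_compl_self (A ∩ B), Set.compl_inter]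
  exact (measure_union_le _ _).trans (add_le_add_right (measure_union_le _ _) _)

theorem ofReal_le_siteLaw_occupiedEvent_inter_goodEvent {c : ℝ} {n m k : ℕ} {ω ε : ℝ}
    (hm : m ≠ 0) (hL : Layout c n m k ω ε)
    (hbad : m * (ridgesWidth c n + 2 * ε + k * (ω + 3 * ε)) ≤ occupancy c / 2) {i : ℕ}
    (hi : i < k) : ENNReal.ofReal (occupancy c / 2) ≤
      siteLaw m (occupiedEvent c m i ∩ goodEvent c n m k ω ε) := by
  have hoccupied := siteLaw_compl_occupiedEvent_le hm hL.side_pos hL.fit hi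
  have hgood := (siteLaw_compl_goodEvent_le m k (ridgesWidth_pos hL.c_pos n).le hL.ω_nonneg
    hL.ε_pos.le).trans (ENNReal.ofReal_le_ofReal hbad)
  have hle : 0 ≤ 1 - occupancy c := by simpa [occupancy] using Real.exp_nonneg _
  have hnonneg : 0 ≤ occupancy c / 2 := hbad.trans' <| by
    have := ridgesWidth_pos hL.c_pos n
    have := hL.ω_nonneg
    have := hL.ε_pos
    positivity
  calc ENNReal.ofReal (occupancy c / 2)
      = 1 - (ENNReal.ofReal (1 - occupancy c) + ENNReal.ofReal (occupancy c / 2)) := by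
        rw [← ENNReal.ofReal_add hle hnonneg, ← ENNReal.ofReal_one,
          ← ENNReal.ofReal_sub _ (by linarith)]
        congr 1
        ring
    _ ≤ 1 - (siteLaw m (occupiedEvent c m i)ᶜ + siteLaw m (goodEvent c n m k ω ε)ᶜ) := by
        gcongr
    _ ≤ _ := one_sub_le_measure_inter _ _ _

namespace IsFarmingTerrain

variable {T : Terrain} {c : ℝ} {n m k : ℕ} {ω ε h : ℝ}
  (hT : IsFarmingTerrain T c n m k ω ε h) (hA : Admissible c n m k ω ε h)

include hT hA

theorem mul_card_occupied_le_add {P : Fin m → unitSquare} (hP : P ∈ goodEvent c n m k ω ε) :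
    (n * (occupied c m k P).card : ℝ≥0∞) ≤ T.voronoiComplexity P + n := by
  have hcomplexity : (((2 * n - 1) * ((occupied c m k P).card - 1) : ℕ) : ℝ≥0∞) ≤
      T.voronoiComplexity P := by
    simpa using ENat.toENNReal_le.2 (hT.mul_card_occupied_le hA fun a =>
      hT.height_eq_zero_or_mem_farm hA.ω_nonneg (hP a))
  have hnat : n * (occupied c m k P).card ≤
      (2 * n - 1) * ((occupied c m k P).card - 1) + n := by
    have hn := hA.one_le_n
    rcases (occupied c m k P).card with _ | N
    · simp
    · rw [Nat.add_sub_cancel, mul_add_one]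
      gcongr
      omega
  exact (mod_cast hnat : (_ : ℝ≥0∞) ≤ _).trans (add_le_add_left hcomplexity _)

theorem mul_sum_indicator_le (P : Fin m → unitSquare) :
    (n : ℝ≥0∞) * ∑ i ∈ Finset.range k,
      (occupiedEvent c m i ∩ goodEvent c n m k ω ε).indicator 1 P ≤ T.voronoiComplexity P + n := by
  classical
  by_cases hP : P ∈ goodEvent c n m k ω ε
  · refine le_trans (le_of_eq ?_) (hT.mul_card_occupied_le_add hA hP)
    rw [occupied, Finset.card_filter, Nat.cast_sum]
    simp [Set.indicator_apply, hP, occupiedEvent]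
  · simp [hP]

theorem mul_sum_siteLaw_le :
    n * ∑ i ∈ Finset.range k, siteLaw m (occupiedEvent c m i ∩ goodEvent c n m k ω ε) ≤
      expectedComplexity T m + n := by
  have hmeas (i : ℕ) : MeasurableSet (occupiedEvent c m i ∩ goodEvent c n m k ω ε) :=
    (measurableSet_occupiedEvent c m i).inter (measurableSet_goodEvent c n m k ω ε)
  have hind (i : ℕ) : Measurable
      ((occupiedEvent c m i ∩ goodEvent c n m k ω ε).indicator (1 : (Fin m → unitSquare) → ℝ≥0∞)) :=
    measurable_one.indicator (hmeas i)
  calc n * ∑ i ∈ Finset.range k, siteLaw m (occupiedEvent c m i ∩ goodEvent c n m k ω ε)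
      = ∫⁻ P, n * ∑ i ∈ Finset.range k,
          (occupiedEvent c m i ∩ goodEvent c n m k ω ε).indicator 1 P ∂siteLaw m := by
        rw [lintegral_const_mul _ (Finset.measurable_sum _ fun i _ => hind i),
          lintegral_finsetSum _ fun i _ => hind i]
        simp_rw [lintegral_indicator_one (hmeas _)]
    _ ≤ ∫⁻ P, ((T.voronoiComplexity P : ℝ≥0∞) + n) ∂siteLaw m :=
        lintegral_mono (hT.mul_sum_indicator_le hA)
    _ = expectedComplexity T m + n := by
        rw [lintegral_add_right _ measurable_const, lintegral_const, measure_univ, mul_one,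
          expectedComplexity]

theorem ofReal_le_expectedComplexity (hm : m ≠ 0)
    (hbad : m * (ridgesWidth c n + 2 * ε + k * (ω + 3 * ε)) ≤ occupancy c / 2) :
    ENNReal.ofReal (n * (k * (occupancy c / 2)) - n) ≤ expectedComplexity T m := by
  rw [ENNReal.ofReal_sub _ n.cast_nonneg, ENNReal.ofReal_natCast, tsub_le_iff_right,
    ENNReal.ofReal_mul n.cast_nonneg, ENNReal.ofReal_mul k.cast_nonneg, ENNReal.ofReal_natCast,
    ENNReal.ofReal_natCast]
  refine le_trans ?_ (hT.mul_sum_siteLaw_le hA)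
  gcongr
  simpa using Finset.card_nsmul_le_sum (Finset.range k) _ _ fun i hi =>
    ofReal_le_siteLaw_occupiedEvent_inter_goodEvent hm hA.toLayout hbad (Finset.mem_range.1 hi)

end IsFarmingTerrain

end Measure

section Parameters

open Filter Topology

theorem occupancy_pos {c : ℝ} (hc : c ≠ 0) : 0 < occupancy c :=
  sub_pos.2 (Real.exp_lt_one_iff.2 (neg_lt_zero.2 (by positivity)))

theorem occupancy_lt_one (c : ℝ) : occupancy c < 1 :=
  sub_lt_self 1 (Real.exp_pos _)

theorem tendsto_mul_ridgesWidth (c : ℝ) :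
    Tendsto (fun n : ℕ => n * ridgesWidth c n) atTop (𝓝 0) := by
  have hpow := (tendsto_self_mul_const_pow_of_lt_one (r := 1 / 2) (by norm_num)
    (by norm_num)).const_mul (1 / (√2 * c))
  rw [mul_zero] at hpow
  refine hpow.congr fun n => ?_
  rw [ridgesWidth, one_div_pow]
  ring

/-- The bound on the widths of the roads and of the boundary regions: roads and boundary regions
this narrow contain one of the `m` sites with probability at most `occupancy c / 4`. -/
def tolerance (c : ℝ) (m : ℕ) : ℝ := occupancy c * farmSide c m / (8 * m)

theorem exists_forall_le_mul_sqrt {a : ℝ} (ha : 0 < a) (b : ℝ) :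
    ∃ m₀ : ℕ, ∀ m ≥ m₀, m ≠ 0 ∧ b ≤ a * √(m : ℝ) :=
  eventually_atTop.1 <| (eventually_ne_atTop 0).and <|
    ((Real.tendsto_sqrt_atTop.comp tendsto_natCast_atTop_atTop).const_mul_atTop
      ha).eventually_ge_atTop b

theorem exists_forall_mul_ridgesWidth_le {c : ℝ} (hc : 0 < c) (C : ℝ) :
    ∃ n₀ : ℕ, ∀ n ≥ n₀, ∀ m : ℕ, m ≠ 0 → m ≤ C * n →
      1 ≤ n ∧ c * √(m : ℝ) ≤ n ∧ ridgesWidth c n ≤ farmSide c m / 4 ∧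
        m * ridgesWidth c n ≤ occupancy c / 4 := by
  have hδ : 0 < min (1 / (4 * c)) (occupancy c / 4) :=
    lt_min (by positivity) (div_pos (occupancy_pos hc.ne') four_pos)
  have hsmall := ((tendsto_mul_ridgesWidth c).const_mul C).eventually_le_const
    ((mul_zero C).trans_lt hδ)
  have hlarge := tendsto_natCast_atTop_atTop.eventually_ge_atTop (c ^ 2 * C)
  refine eventually_atTop.1 ?_
  filter_upwards [hsmall, hlarge, eventually_ge_atTop 1] with n hsmall hlarge hn m hm hmC
  have hwidth := ridgesWidth_pos hc n
  have hmW : m * ridgesWidth c n ≤ min (1 / (4 * c)) (occupancy c / 4) :=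
    (mul_le_mul_of_nonneg_right hmC hwidth.le).trans ((mul_assoc _ _ _).trans_le hsmall)
  have hm1 : (1 : ℝ) ≤ m := by exact_mod_cast Nat.one_le_iff_ne_zero.2 hm
  have hsq := Real.sq_sqrt (Nat.cast_nonneg (α := ℝ) m)
  refine ⟨hn, ?_, ?_, hmW.trans (min_le_right _ _)⟩
  · refine abs_le_of_sq_le_sq' ?_ n.cast_nonneg |>.2
    rw [mul_pow, hsq]
    nlinarith [mul_le_mul_of_nonneg_left hmC (sq_nonneg c)]
  · calc ridgesWidth c n ≤ 1 / (4 * c) / √(m : ℝ) := by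
          rw [le_div_iff₀ (by positivity), mul_comm]
          refine le_trans ?_ (hmW.trans (min_le_left _ _))
          gcongr
          exact Real.sqrt_le_self_iff.2 (.inr hm1)
      _ = farmSide c m / 4 := by
          rw [farmSide]
          ring

variable {c : ℝ} {n m k : ℕ} {ω ε h : ℝ}

theorem tolerance_pos (hc : 0 < c) (hm : m ≠ 0) : 0 < tolerance c m := by
  have := occupancy_pos hc.ne'
  unfold tolerance farmSide
  positivity

theorem tolerance_le (hm : m ≠ 0) (hs : 0 ≤ farmSide c m) : tolerance c m ≤ farmSide c m / 8 := by
  have hm1 : (1 : ℝ) ≤ m := by exact_mod_cast Nat.one_le_iff_ne_zero.2 hm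
  rw [tolerance, div_le_div_iff₀ (by positivity) (by norm_num)]
  nlinarith [occupancy_lt_one c]

theorem Admissible.of_lt_tolerance (hc : 0 < c) (hn : 1 ≤ n) (hm : m ≠ 0) (hk : k ≠ 0)
    (hkc : 3 * k ≤ c * √(m : ℝ)) (hW : ridgesWidth c n ≤ farmSide c m / 4) (hω0 : 0 ≤ ω)
    (hω : ω < tolerance c m) (hε0 : 0 < ε) (hε : ε < tolerance c m) (hh : 4 ≤ h) :
    Admissible c n m k ω ε h := by
  have hs : 0 < farmSide c m := by unfold farmSide; positivity
  have hη := tolerance_le hm hs.le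
  have hk1 : (1 : ℝ) ≤ k := by exact_mod_cast Nat.one_le_iff_ne_zero.2 hk
  have hfit : 3 * k * farmSide c m ≤ 1 := by
    rw [farmSide, mul_one_div]
    exact div_le_one_of_le₀ hkc (by positivity)
  exact {
    c_pos := hc
    one_le_n := hn
    side_pos := hs
    fit := hfit
    ω_nonneg := hω0
    ε_pos := hε0
    ω_lt := by linarith
    gap := by rw [ridgesWest]; nlinarith
    narrow := by linarith
    high := hh }

theorem mul_add_le_occupancy_of_lt_tolerance (hc : 0 < c) (hm : m ≠ 0) (hk : k ≠ 0)
    (hfit : 3 * k * farmSide c m ≤ 1) (hW : m * ridgesWidth c n ≤ occupancy c / 4)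
    (hω : ω < tolerance c m) (hε : ε < tolerance c m) :
    m * (ridgesWidth c n + 2 * ε + k * (ω + 3 * ε)) ≤ occupancy c / 2 := by
  have hk1 : (1 : ℝ) ≤ k := by exact_mod_cast Nat.one_le_iff_ne_zero.2 hk
  have hstrips : 2 * ε + k * (ω + 3 * ε) ≤ 6 * k * tolerance c m := by
    have hη := tolerance_pos hc hm
    nlinarith
  calc m * (ridgesWidth c n + 2 * ε + k * (ω + 3 * ε))
      = m * ridgesWidth c n + m * (2 * ε + k * (ω + 3 * ε)) := by ring
    _ ≤ occupancy c / 4 + m * (6 * k * tolerance c m) := by gcongr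
    _ = occupancy c / 4 + occupancy c / 4 * (3 * k * farmSide c m) := by
        rw [tolerance]
        field_simp
        ring
    _ ≤ occupancy c / 4 + occupancy c / 4 * 1 := by
        gcongr
        exact (div_pos (occupancy_pos hc.ne') four_pos).le
    _ = occupancy c / 2 := by ring

end Parameters

end Farming

end

theorem mainTheorem3 (c κ : ℝ) (hc : 0 < c) (hκ : 0 < κ) :
    ∃ (A K : ℝ) (m₀ : ℕ), 0 < K ∧ ∀ C : ℝ, ∃ n₀ : ℕ, ∀ n m : ℕ,
      n₀ ≤ n → m₀ ≤ m → (m : ℝ) ≤ C * n →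
      ∃ η h₀ : ℝ, 0 < η ∧ ∀ (k : ℕ) (ω ε h : ℝ),
        κ * √(m : ℝ) ≤ k → 3 * (k : ℝ) ≤ c * √(m : ℝ) →
        0 ≤ ω → ω < η → 0 < ε → ε < η → h₀ ≤ h →
        (∃ T : Farming.Terrain, Farming.IsFarmingTerrain T c n m k ω ε h ∧
          (T.triangulation.vertices.ncard : ℝ) ≤ A * n) ∧
        ∀ T : Farming.Terrain, Farming.IsFarmingTerrain T c n m k ω ε h →
          ENNReal.ofReal (K * (n * √(m : ℝ))) ≤ Farming.expectedComplexity T m := by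
  open Farming in
  have hp : 0 < occupancy c := occupancy_pos hc.ne'
  obtain ⟨m₀, hm₀⟩ := exists_forall_le_mul_sqrt (mul_pos hκ hp) 4
  refine ⟨24, κ * occupancy c / 4, m₀, by positivity, fun C => ?_⟩
  obtain ⟨n₀, hn₀⟩ := exists_forall_mul_ridgesWidth_le hc C
  refine ⟨n₀, fun n m hn hm hmC => ?_⟩
  obtain ⟨hm0, hmκ⟩ := hm₀ m hm
  obtain ⟨hn1, hcn, hWs, hWm⟩ := hn₀ n hn m hm0 hmC
  refine ⟨tolerance c m, 4, tolerance_pos hc hm0, fun k ω ε h hκk hkc hω hωη hε hεη hh => ?_⟩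
  have hk0 : k ≠ 0 := Nat.cast_ne_zero.1 (hκk.trans_lt' (by positivity)).ne'
  have hA := Admissible.of_lt_tolerance hc hn1 hm0 hk0 hkc hWs hω hωη hε hεη hh
  refine ⟨?_, fun T hT => ?_⟩
  · obtain ⟨T, hT, hcard⟩ := hA.exists_isFarmingTerrain (by linarith)
    refine ⟨T, hT, (Nat.cast_le.2 hcard).trans ?_⟩
    have : (1 : ℝ) ≤ n := by exact_mod_cast hn1
    push_cast
    linarith
  · refine (ENNReal.ofReal_le_ofReal ?_).trans (hT.ofReal_le_expectedComplexity hA hm0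
      (mul_add_le_occupancy_of_lt_tolerance hc hm0 hk0 hA.fit hWm hωη hεη))
    have hkp : κ * occupancy c / 4 * √(m : ℝ) ≤ k * (occupancy c / 2) - 1 := by
      linarith [mul_le_mul_of_nonneg_right hκk hp.le]
    linarith [mul_le_mul_of_nonneg_left hkp n.cast_nonneg]
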